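/- Let $k\ge 2$. A Fatou–Bieberbach domain in $\mathbb{C}^k$ is a connected open set $\Omega\subsetneq\mathbb{C}^k$ that is biholomorphic to $\mathbb{C}^k$. For a holomorphic automorphism $F$ of $\mathbb{C}^k$ and a point $p\in\mathbb{C}^k$, let $$\Omega^p_{\{F\}}=\{z\in\mathbb{C}^k : \lim_{j\to\infty}F^{j}(z)=p\}$$ be the basin of attraction of $p$, where $F^j$ is the $j$-th iterate of $F$. Then there exists a Fatou–Bieberbach domain $\Omega\subset\mathbb{C}^k$ that is contained and dense in the complement $\mathbb{C}^k\setminus\overline{B}$ of the closed unit ball $\overline{B}=\{z : \|z\|\le 1\}$, and such that there are no holomorphic automorphism $F$ of $\mathbb{C}^k$ and no point $p\in\mathbb{C}^k$ with $\Omega=\Omega^p_{\{F\}}$. -/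

import Mathlib

open Filter Topology

/-- Complex Euclidean space `ℂ^k`. -/
abbrev ComplexSpace (k : ℕ) : Type := EuclideanSpace ℂ (Fin k)

/-- `F` is a holomorphic automorphism of `ℂ^k`: a holomorphic self-map with a holomorphic
two-sided inverse. -/
def IsHolomorphicAut {k : ℕ} (F : ComplexSpace k → ComplexSpace k) : Prop :=
  Differentiable ℂ F ∧ ∃ G : ComplexSpace k → ComplexSpace k,
    Differentiable ℂ G ∧ Function.LeftInverse G F ∧ Function.RightInverse G F

/-- A Fatou-Bieberbach domain in `ℂ^k`: a proper subdomain (connected open subset) of `ℂ^k`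
which is biholomorphic to `ℂ^k`. -/
structure IsFatouBieberbachDomain {k : ℕ} (Ω : Set (ComplexSpace k)) : Prop where
  isOpen : IsOpen Ω
  isConnected : IsConnected Ω
  ne_univ : Ω ≠ Set.univ
  biholomorphic : ∃ Φ Ψ : ComplexSpace k → ComplexSpace k,
    Differentiable ℂ Φ ∧ DifferentiableOn ℂ Ψ Ω ∧
      (∀ z, Φ z ∈ Ω) ∧ (∀ z, Ψ (Φ z) = z) ∧ (∀ w ∈ Ω, Φ (Ψ w) = w)

/-- The composition `F_j ∘ ⋯ ∘ F_1` of the first `j` maps of a sequence; the `i`-th map of the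
sequence is `F (i - 1)` here, and the empty composition is the identity. -/
def seqComp {X : Type*} (F : ℕ → X → X) : ℕ → X → X
  | 0 => id
  | j + 1 => F j ∘ seqComp F j

/-- The basin of attraction of the point `p` for the sequence of maps `F`. -/
def attractingBasin {k : ℕ} (F : ℕ → ComplexSpace k → ComplexSpace k) (p : ComplexSpace k) :
    Set (ComplexSpace k) :=
  {z | Tendsto (fun j => seqComp F j z) atTop (𝓝 p)}

/-- For a constant sequence the compositions are the iterates of the map. -/
theorem seqComp_const {X : Type*} (F : X → X) (j : ℕ) : seqComp (fun _ => F) j = F^[j] := by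
  induction j with
  | zero => rfl
  | succ j ih => rw [seqComp, ih, Function.iterate_succ']

/-!
The domain is obtained by the push-out method. One builds automorphisms `Φ n` of `ℂ^k`, each a
small perturbation of the previous one on a ball whose radius `R n` tends to infinity
(`IsPushOut`). The points whose orbit `Φ n z` converges form an open set, and because the errors
are chosen after `Φ n` is known, small compared with the modulus of continuity of its inverse, the
inverses converge locally uniformly on all of `ℂ^k` to a biholomorphic parametrization of that set
(`IsPushOut.exists_biholomorphic`). It remains to choose the `Φ n` so that the closed unit ball
`B` escapes to infinity while each point of a dense sequence outside `B` is trapped.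

Apart from an initial translation, all automorphisms used are compositions of shears `z ↦ z + h
⟪u, z⟫ v` with `⟪u, v⟫ = 0`. If `h` is nearly `0` on the disc of radius `R`, nearly a large
constant on `⟪u, Φ B⟫`, and zero at `⟪u, Φ q⟫`, then the shear is nearly the identity on the ball
of radius `R`, moves `Φ B` far away almost as a rigid translation, and fixes `Φ q`
(`exists_push`). Such an `h` is explicit (`exists_entire_approx_step_vanishing`). It is needed
that a real hyperplane strictly separates `Φ q` from `Φ B`, however close `q` is to `B`. Therefore
one keeps `Φ` close to a translation on `B` to second order (`IsNearTranslation`); the strong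
convexity of the ball then yields the separation (`IsNearTranslation.exists_separating`). When
`⟪u, Φ B⟫` is too close to the origin, either the direction of `Φ 0` separates as well, or a
preliminary shear first translates `Φ B` and `Φ q` together (`exists_step`).

On the other hand, suppose that an open set `Ω`, contained and dense in the complement of `B`, is
the basin of `p` for an automorphism `F`. Then `F` preserves `Ω`, hence the complement of its
closure, the open ball, hence the unit sphere. Polarizing `‖F x‖ = 1` along complexified torus
orbits gives `⟪F z, F w⟫ = 1` for many pairs `z, w` off the sphere, and likewise for the iterates
of `F` (`inner_map_polarPartner_map_eq_one`). As `Ω` contains such a pair, the limit gives `⟪p, p⟫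
= 1`; but `p` is a fixed point of `F`, so `p ∈ Ω` and `‖p‖ > 1`, a contradiction
(`ne_attractingBasin_of_dense_compl_closedBall`).
-/

/-! ### Holomorphic maps: Cauchy estimates, limits and approximation -/

theorem norm_fderiv_le_of_norm_le_on_ball {E F : Type*} [NormedAddCommGroup E] [NormedSpace ℂ E]
    [NormedAddCommGroup F] [NormedSpace ℂ F] {g : E → F} {z : E} {s ε : ℝ} (hs : 0 < s)
    (hg : DifferentiableOn ℂ g (Metric.ball z s)) (hb : ∀ w ∈ Metric.ball z s, ‖g w‖ ≤ ε) :
    ‖fderiv ℂ g z‖ ≤ 2 * ε / s := by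
  refine Complex.norm_fderiv_le_div_of_mapsTo_ball hg (fun w hw => ?_) hs
  rw [Metric.mem_closedBall, dist_eq_norm]
  have h1 := hb w hw
  have h2 := hb z (Metric.mem_ball_self hs)
  linarith [norm_sub_le (g w) (g z)]

/-- Cauchy's estimate for the first-order Taylor remainder. Only `‖g y‖ ≤ ε` is required of `y`,
which may lie outside the ball. -/
theorem norm_taylor_remainder_le_of_norm_le_on_ball {E F : Type*} [NormedAddCommGroup E]
    [NormedSpace ℂ E] [NormedAddCommGroup F] [NormedSpace ℂ F] {g : E → F} {z y : E} {s ε : ℝ}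
    (hs : 0 < s) (hg : DifferentiableOn ℂ g (Metric.ball z s))
    (hb : ∀ w ∈ Metric.ball z s, ‖g w‖ ≤ ε) (hy : ‖g y‖ ≤ ε) :
    ‖g y - g z - fderiv ℂ g z (y - z)‖ ≤ 4 * ε / s ^ 2 * ‖y - z‖ ^ 2 := by
  have hz := hb z (Metric.mem_ball_self hs)
  have hε : 0 ≤ ε := (norm_nonneg _).trans hz
  have hD := norm_fderiv_le_of_norm_le_on_ball hs hg hb
  have hlin (w : E) : ‖fderiv ℂ g z (w - z)‖ ≤ 2 * ε / s * ‖w - z‖ :=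
    (ContinuousLinearMap.le_opNorm _ _).trans (by gcongr)
  rcases lt_or_ge ‖y - z‖ s with h | h
  · have hgz : DifferentiableAt ℂ g z :=
      (hg z (Metric.mem_ball_self hs)).differentiableAt (Metric.ball_mem_nhds z hs)
    have key := Complex.dist_le_mul_div_pow_of_mapsTo_ball_of_isLittleO (n := 1)
      (f := fun w => g w - fderiv ℂ g z (w - z)) (c := z) (z := y) (R₁ := s) (R₂ := 4 * ε)
      (hg.sub (by fun_prop)) (fun w hw => ?_) ?_ (by simpa [dist_eq_norm] using h)
    · simp only [sub_self, map_zero, sub_zero, dist_eq_norm] at key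
      calc _ = ‖g y - fderiv ℂ g z (y - z) - g z‖ := by congr 1; abel
        _ ≤ _ := key
        _ = _ := by ring
    · have hw' : ‖w - z‖ ≤ s := by simpa [dist_eq_norm] using (Metric.mem_ball.1 hw).le
      simp only [sub_self, map_zero, sub_zero, Metric.mem_closedBall, dist_eq_norm]
      have h3 : 2 * ε / s * ‖w - z‖ ≤ 2 * ε := by
        rw [div_mul_eq_mul_div, div_le_iff₀ hs]; gcongr
      have := norm_sub_le (g w - fderiv ℂ g z (w - z)) (g z)
      have := norm_sub_le (g w) (fderiv ℂ g z (w - z))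
      linarith [hb w hw, hlin w]
    · have := hgz.hasFDerivAt.isLittleO.norm_right
      simp only [pow_one]
      refine this.congr_left fun w => ?_
      simp only [sub_self, map_zero, sub_zero]
      abel
  · have h1 : 1 ≤ ‖y - z‖ / s := by rwa [one_le_div hs]
    have h2 := norm_sub_le (g y - g z) (fderiv ℂ g z (y - z))
    have h3 := norm_sub_le (g y) (g z)
    calc _ ≤ 2 * ε + 2 * ε * (‖y - z‖ / s) := by
          have := hlin y
          rw [div_mul_eq_mul_div, ← mul_div_assoc'] at this
          linarith
      _ ≤ 4 * ε * (‖y - z‖ / s) ^ 2 := by nlinarith [mul_nonneg hε (sub_nonneg.2 h1)]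
      _ = _ := by ring

/-- A uniform limit of holomorphic maps between complex normed spaces is holomorphic: by Cauchy's
estimate the derivatives converge uniformly as well. -/
theorem differentiableAt_of_tendstoUniformlyOn_ball {E F : Type*} [NormedAddCommGroup E]
    [NormedSpace ℂ E] [NormedAddCommGroup F] [NormedSpace ℂ F] [CompleteSpace F]
    {f : ℕ → E → F} {g : E → F} {x : E} {ρ : ℝ} (hρ : 0 < ρ) (hf : ∀ n, Differentiable ℂ (f n))
    (h : TendstoUniformlyOn f g atTop (Metric.ball x ρ)) : DifferentiableAt ℂ g x := by
  have hC : UniformCauchySeqOn (fun n => fderiv ℂ (f n)) atTop (Metric.ball x (ρ / 2)) := by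
    rw [Metric.uniformCauchySeqOn_iff]
    intro ε hε
    obtain ⟨N, hN⟩ := Metric.uniformCauchySeqOn_iff.1 h.uniformCauchySeqOn (ε * ρ / 8)
      (by positivity)
    refine ⟨N, fun m hm n hn y hy => ?_⟩
    have hsub : Metric.ball y (ρ / 2) ⊆ Metric.ball x ρ :=
      Metric.ball_subset_ball' (by linarith [Metric.mem_ball.1 hy])
    have := norm_fderiv_le_of_norm_le_on_ball (z := y) (half_pos hρ)
      ((hf m).sub (hf n)).differentiableOn (ε := ε * ρ / 8) (fun w hw => by
        simpa [dist_eq_norm] using (hN m hm n hn w (hsub hw)).le)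
    rw [fderiv_sub (hf m y) (hf n y)] at this
    rw [dist_eq_norm]
    refine this.trans_lt ?_
    rw [div_lt_iff₀ (half_pos hρ)]
    nlinarith [mul_pos hε hρ]
  have hex (y : E) (hy : y ∈ Metric.ball x (ρ / 2)) :
      ∃ L, Tendsto (fun n => fderiv ℂ (f n) y) atTop (𝓝 L) :=
    cauchySeq_tendsto_of_complete (hC.cauchySeq hy)
  choose! L hL using hex
  exact (hasFDerivAt_of_tendstoUniformlyOn Metric.isOpen_ball
    (hC.tendstoUniformlyOn_of_tendsto hL) (fun n y _ => (hf n y).hasFDerivAt)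
    (fun y hy => h.tendsto_at (Metric.ball_subset_ball (by linarith) hy))
    (Metric.mem_ball_self (half_pos hρ))).differentiableAt

/-- Runge approximation of a locally constant function on two discs: an entire function
(a polynomial) that is close to `0` on one disc and close to `1` on another one, small compared
with its distance from the first. The power `(z / c) ^ 4` does so crudely, and the cubic
`3 x ^ 2 - 2 x ^ 3`, of which `0` and `1` are superattracting fixed points, is iterated to improve
the accuracy. -/
theorem exists_entire_approx_step {c : ℂ} {R : ℝ} (hRc : 2 * R ≤ ‖c‖)
    (hc : 100 ≤ ‖c‖) {ε : ℝ} (hε : 0 < ε) :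
    ∃ h : ℂ → ℂ, Differentiable ℂ h ∧ (∀ z, ‖z‖ ≤ R → ‖h z‖ ≤ ε) ∧
      ∀ z, ‖z - c‖ ≤ 2 → ‖h z - 1‖ ≤ ε := by
  set p : ℂ → ℂ := fun x => 3 * x ^ 2 - 2 * x ^ 3 with hp
  have hpd : Differentiable ℂ p := by fun_prop
  have hp0 (x : ℂ) (hx : ‖x‖ ≤ 1 / 10) : ‖p x‖ ≤ 1 / 2 * ‖x‖ := by
    have : p x = x * (x * (3 - 2 * x)) := by simp only [hp]; ring
    rw [this, norm_mul, norm_mul, mul_comm]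
    have h3 : ‖3 - 2 * x‖ ≤ 4 := (norm_sub_le _ _).trans (by simp; linarith)
    gcongr
    nlinarith [norm_nonneg x, norm_nonneg (3 - 2 * x)]
  have hp1 (x : ℂ) : p x - 1 = - p (1 - x) := by simp only [hp]; ring
  have hit0 (n : ℕ) (x : ℂ) (hx : ‖x‖ ≤ 1 / 10) : ‖p^[n] x‖ ≤ (1 / 2) ^ n * (1 / 10) := by
    induction n with
    | zero => simpa using hx
    | succ n ih =>
      rw [Function.iterate_succ_apply']
      have h1 : ((1 : ℝ) / 2) ^ n ≤ 1 := pow_le_one₀ (by norm_num) (by norm_num)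
      refine (hp0 _ (ih.trans (by linarith))).trans ?_
      rw [pow_succ]; linarith
  have hit1 (n : ℕ) (x : ℂ) : p^[n] (1 - x) = 1 - p^[n] x := by
    induction n with
    | zero => rfl
    | succ n ih =>
      rw [Function.iterate_succ_apply', Function.iterate_succ_apply', ih]
      have := hp1 (1 - p^[n] x)
      rw [sub_sub_cancel] at this
      linear_combination this
  obtain ⟨n, hn⟩ := exists_pow_lt_of_lt_one hε (by norm_num : (1 : ℝ) / 2 < 1)
  have hn0 : (0 : ℝ) ≤ (1 / 2) ^ n := by positivity
  have hc0 : c ≠ 0 := by rintro rfl; norm_num at hc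
  have hcpos : 0 < ‖c‖ := norm_pos_iff.2 hc0
  refine ⟨fun z => p^[n] ((z / c) ^ 4), (hpd.iterate n).comp (by fun_prop), fun z hz => ?_,
    fun z hz => ?_⟩
  · have : ‖(z / c) ^ 4‖ ≤ 1 / 10 := by
      rw [norm_pow, norm_div]
      have : ‖z‖ / ‖c‖ ≤ 1 / 2 := by rw [div_le_iff₀ hcpos]; linarith
      calc _ ≤ ((1 : ℝ) / 2) ^ 4 := by gcongr
        _ ≤ _ := by norm_num
    linarith [hit0 n _ this]
  · have : ‖1 - (z / c) ^ 4‖ ≤ 1 / 10 := by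
      set t := (z - c) / c with ht
      have h1 : z / c = 1 + t := by rw [ht]; field_simp; ring
      have h2 : ‖t‖ ≤ 1 / 50 := by
        rw [ht, norm_div, div_le_iff₀ hcpos]; linarith
      have h3 : 1 - (z / c) ^ 4 = - (t * (4 + t * (6 + t * (4 + t)))) := by rw [h1]; ring
      have h4 : ‖4 + t‖ ≤ 5 := (norm_add_le _ _).trans (by simp; linarith)
      have h5 : ‖6 + t * (4 + t)‖ ≤ 7 := (norm_add_le _ _).trans (by
        simp only [norm_mul, Complex.norm_ofNat]; nlinarith [norm_nonneg t, norm_nonneg (4 + t)])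
      have h6 : ‖4 + t * (6 + t * (4 + t))‖ ≤ 5 := (norm_add_le _ _).trans (by
        rw [norm_mul, Complex.norm_ofNat]
        nlinarith [norm_nonneg t, norm_nonneg (6 + t * (4 + t))])
      rw [h3, norm_neg, norm_mul]
      nlinarith [norm_nonneg t, norm_nonneg (4 + t * (6 + t * (4 + t)))]
    have h2 := hit0 n _ this
    rw [hit1, ← norm_neg, neg_sub] at h2
    linarith

/-- The function of `exists_entire_approx_step` can moreover be made to vanish at a given point `ζ`,
if closeness to `1` is asked only on the part of the second disc that a vertical line separates
from `ζ`: multiply by `1 - exp (n (z - ζ))`. -/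
theorem exists_entire_approx_step_vanishing {c ζ : ℂ} {R d : ℝ} (hRc : 2 * R ≤ ‖c‖)
    (hc : 100 ≤ ‖c‖) (hd : 0 < d) {ε : ℝ} (hε : 0 < ε) :
    ∃ h : ℂ → ℂ, Differentiable ℂ h ∧ (∀ z, ‖z‖ ≤ R → ‖h z‖ ≤ ε) ∧ h ζ = 0 ∧
      ∀ z, ‖z - c‖ ≤ 2 → z.re ≤ ζ.re - d → ‖h z - 1‖ ≤ ε := by
  obtain ⟨n, hn⟩ := exists_pow_lt_of_lt_one (show 0 < ε / 2 by positivity)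
    (Real.exp_lt_one_iff.2 (neg_lt_zero.2 hd) : Real.exp (-d) < 1)
  rw [← Real.exp_nat_mul] at hn
  set k : ℂ → ℂ := fun z => 1 - Complex.exp (n * (z - ζ)) with hk
  set A : ℝ := 2 + Real.exp (n * (R + ‖ζ‖)) with hA
  have hA0 : 2 < A := by linarith [Real.exp_pos (n * (R + ‖ζ‖))]
  obtain ⟨h, hh, h0, h1⟩ := exists_entire_approx_step hRc hc
    (show 0 < min ε 1 / (2 * A) from by have := lt_min hε one_pos; positivity)
  have hmin : 0 < min ε 1 := lt_min hε one_pos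
  have hkn (z : ℂ) : ‖Complex.exp (n * (z - ζ))‖ = Real.exp (n * (z.re - ζ.re)) := by
    rw [Complex.norm_exp]; simp
  -- the factor `k` is bounded by `A` on the disc around `0`, so `h` is made small relative to `A`
  refine ⟨fun z => h z * k z, hh.mul (by fun_prop), fun z hz => ?_, by simp [hk],
    fun z hz hz' => ?_⟩
  · have h2 : ‖k z‖ ≤ A := by
      refine (norm_sub_le _ _).trans ?_
      rw [hkn, norm_one]
      have : Real.exp (n * (z.re - ζ.re)) ≤ Real.exp (n * (R + ‖ζ‖)) := by
        gcongr
        have := Complex.abs_re_le_norm z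
        have := Complex.abs_re_le_norm ζ
        have := neg_abs_le ζ.re
        have := le_abs_self z.re
        linarith
      linarith
    calc ‖h z * k z‖ = ‖h z‖ * ‖k z‖ := norm_mul _ _
      _ ≤ min ε 1 / (2 * A) * A := by gcongr; exact h0 z hz
      _ = min ε 1 / 2 := by field_simp
      _ ≤ ε := by linarith [min_le_left ε 1]
  · have h2 : ‖k z - 1‖ ≤ ε / 2 := by
      simp only [hk, sub_sub_cancel_left, norm_neg]
      rw [hkn]
      refine le_trans (Real.exp_le_exp.2 ?_) hn.le
      gcongr
      linarith
    have h2' : ‖k z‖ ≤ 2 := by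
      have : ‖k z - 1‖ ≤ 1 := by
        simp only [hk, sub_sub_cancel_left, norm_neg]
        rw [hkn, Real.exp_le_one_iff]
        exact mul_nonpos_of_nonneg_of_nonpos (by positivity) (by linarith)
      calc ‖k z‖ = ‖(k z - 1) + 1‖ := by ring_nf
        _ ≤ _ := norm_add_le _ _
        _ ≤ 2 := by rw [norm_one]; linarith
    calc ‖h z * k z - 1‖ = ‖(h z - 1) * k z + (k z - 1)‖ := by ring_nf
      _ ≤ ‖h z - 1‖ * ‖k z‖ + ‖k z - 1‖ := (norm_add_le _ _).trans (by rw [norm_mul])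
      _ ≤ min ε 1 / (2 * A) * 2 + ε / 2 := by gcongr; exact h1 z hz
      _ ≤ ε / 2 + ε / 2 := by
        gcongr
        rw [div_mul_eq_mul_div, div_le_iff₀ (by positivity)]
        nlinarith [min_le_left ε 1]
      _ = ε := by ring

/-! ### Maps preserving the unit sphere, and basins of attraction -/

/-- Polarization of `‖F x‖ = 1`. With `e^{lτ}` the diagonal action, the function
`l ↦ ⟪F (e^{-l̄τ} x), F (e^{lτ} x)⟫` is entire, and it equals `1` on the imaginary axis, where the
two arguments agree and lie on the sphere; it is evaluated at `l = 1`. -/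
theorem inner_map_exp_neg_map_exp_eq_one {k : ℕ} {F : ComplexSpace k → ComplexSpace k}
    (hF : Differentiable ℂ F) (hS : ∀ x, ‖x‖ = 1 → ‖F x‖ = 1) (τ : Fin k → ℝ)
    {x : ComplexSpace k} (hx : ‖x‖ = 1) :
    inner ℂ (F (WithLp.toLp 2 fun i => Complex.exp (-τ i) * x i))
      (F (WithLp.toLp 2 fun i => Complex.exp (τ i) * x i)) = 1 := by
  set D : ℂ → ComplexSpace k := fun l => WithLp.toLp 2 fun i => Complex.exp (l * τ i) * x i with hD
  have hDd : Differentiable ℂ D := by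
    rw [differentiable_euclidean]
    intro i
    simp only [hD]
    fun_prop
  set H : ℂ → ℂ := fun l => inner ℂ (F (D (-(starRingEnd ℂ) l))) (F (D l)) with hH
  have hFc (i : Fin k) : Differentiable ℂ fun l => F (D l) i :=
    (differentiable_euclidean.1 (hF.comp hDd)) i
  have hHd : Differentiable ℂ H := by
    have : H = fun l => ∑ i, F (D l) i *
        (starRingEnd ℂ) ((fun m => F (D (-m)) i) ((starRingEnd ℂ) l)) := by
      funext l
      simp [hH, PiLp.inner_apply]
    rw [this]
    refine Differentiable.fun_sum fun i _ => (hFc i).mul ?_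
    have h2 : Differentiable ℂ fun m => F (D (-m)) i := (hFc i).comp differentiable_neg
    intro l
    simpa [Function.comp_def] using (h2 ((starRingEnd ℂ) l)).conj_conj
  have hI (t : ℝ) : H (Complex.I * t) = 1 := by
    have h1 : -(starRingEnd ℂ) (Complex.I * t) = Complex.I * t := by simp
    have h2 : ‖D (Complex.I * t)‖ = 1 := by
      rw [← hx, EuclideanSpace.norm_eq, EuclideanSpace.norm_eq]
      congr 2
      funext i
      have : Complex.I * t * τ i = ((t * τ i : ℝ) : ℂ) * Complex.I := by push_cast; ring
      simp only [hD, norm_mul, this, Complex.norm_exp_ofReal_mul_I, one_mul]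
    simp only [hH, h1]
    rw [inner_self_eq_norm_sq_to_K, hS _ h2]
    simp
  have hconst : H = fun _ => 1 := by
    refine AnalyticOnNhd.eq_of_frequently_eq (z₀ := 0)
      (fun z _ => hHd.analyticAt z) analyticOnNhd_const ?_
    have ht : Tendsto (fun t : ℝ => Complex.I * t) (𝓝[≠] 0) (𝓝[≠] 0) := by
      refine tendsto_nhdsWithin_iff.2 ⟨?_, ?_⟩
      · have : Continuous fun t : ℝ => Complex.I * t := by fun_prop
        simpa using (this.tendsto 0).mono_left nhdsWithin_le_nhds
      · filter_upwards [self_mem_nhdsWithin] with t ht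
        simpa using ht
    exact ht.frequently (Eventually.of_forall hI).frequently
  have := congrFun hconst 1
  simpa [hH, hD] using this

/-- The diagonal linear map with real entries `d`. -/
noncomputable def diagMap {k : ℕ} (d : Fin k → ℝ) (w : ComplexSpace k) : ComplexSpace k :=
  WithLp.toLp 2 fun i => d i * w i

/-- The point `D² w / ‖D w‖²`, where `D` is the diagonal map with entries `d`. Its inner product
with `w` is `1`; for positive `d` the two points are `e^{-τ} x` and `e^{τ} x` for a unit vector `x`
and a real vector `τ`. -/
noncomputable def polarPartner {k : ℕ} (d : Fin k → ℝ) (w : ComplexSpace k) : ComplexSpace k :=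
  ((‖diagMap d w‖ ^ 2)⁻¹ : ℝ) • diagMap d (diagMap d w)

theorem continuous_diagMap {k : ℕ} (d : Fin k → ℝ) : Continuous (diagMap d) := by
  unfold diagMap
  fun_prop

theorem diagMap_ne_zero {k : ℕ} {d : Fin k → ℝ} (hd : ∀ i, 0 < d i) {w : ComplexSpace k}
    (hw : w ≠ 0) : diagMap d w ≠ 0 := by
  contrapose! hw
  ext i
  have := congrArg (fun v : ComplexSpace k => v i) hw
  simpa [diagMap, (hd i).ne'] using this

theorem continuousAt_polarPartner {k : ℕ} {d : Fin k → ℝ} (hd : ∀ i, 0 < d i)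
    {w : ComplexSpace k} (hw : w ≠ 0) : ContinuousAt (polarPartner d) w := by
  have h := continuous_diagMap d
  have h0 : ‖diagMap d w‖ ^ 2 ≠ 0 := pow_ne_zero 2 (norm_ne_zero_iff.2 (diagMap_ne_zero hd hw))
  exact ContinuousAt.smul ((h.norm.pow 2).continuousAt.inv₀ h0) (h.comp h).continuousAt

theorem polarPartner_ne_zero {k : ℕ} {d : Fin k → ℝ} (hd : ∀ i, 0 < d i) {w : ComplexSpace k}
    (hw : w ≠ 0) : polarPartner d w ≠ 0 := by
  have h := diagMap_ne_zero hd hw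
  exact smul_ne_zero (inv_ne_zero (pow_ne_zero 2 (norm_ne_zero_iff.2 h))) (diagMap_ne_zero hd h)

theorem polarPartner_inv_polarPartner {k : ℕ} {d : Fin k → ℝ} (hd : ∀ i, 0 < d i)
    {w : ComplexSpace k} (hw : w ≠ 0) : polarPartner (fun i => (d i)⁻¹) (polarPartner d w) = w := by
  have h0 : ‖diagMap d w‖ ≠ 0 := norm_ne_zero_iff.2 (diagMap_ne_zero hd hw)
  have h1 : diagMap (fun i => (d i)⁻¹) (polarPartner d w)
      = ((‖diagMap d w‖ ^ 2)⁻¹ : ℝ) • diagMap d w := by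
    ext i
    have : (d i : ℂ) ≠ 0 := by exact_mod_cast (hd i).ne'
    simp only [diagMap, polarPartner, PiLp.smul_apply, Complex.real_smul]
    push_cast
    field_simp
  rw [polarPartner, h1, norm_smul]
  ext i
  have : (d i : ℂ) ≠ 0 := by exact_mod_cast (hd i).ne'
  have h0' : (‖diagMap d w‖ : ℂ) ≠ 0 := by exact_mod_cast h0
  set N := ‖diagMap d w‖
  simp only [diagMap, PiLp.smul_apply, Complex.real_smul, norm_inv, norm_pow, Real.norm_eq_abs,
    sq_abs]
  push_cast
  have h0'' : (N : ℂ) ≠ 0 := h0'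
  field_simp

theorem inner_map_polarPartner_map_eq_one {k : ℕ} {F : ComplexSpace k → ComplexSpace k}
    (hF : Differentiable ℂ F) (hS : ∀ x, ‖x‖ = 1 → ‖F x‖ = 1) {d : Fin k → ℝ}
    (hd : ∀ i, 0 < d i) {w : ComplexSpace k} (hw : w ≠ 0) :
    inner ℂ (F (polarPartner d w)) (F w) = 1 := by
  have h0 : 0 < ‖diagMap d w‖ := norm_pos_iff.2 (diagMap_ne_zero hd hw)
  set N := ‖diagMap d w‖ with hN
  have h0' : (N : ℂ) ≠ 0 := by exact_mod_cast h0.ne'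
  have hx : ‖(N⁻¹ : ℝ) • diagMap d w‖ = 1 := by
    rw [norm_smul, ← hN, norm_inv, Real.norm_eq_abs, abs_of_pos h0, inv_mul_cancel₀ h0.ne']
  have := inner_map_exp_neg_map_exp_eq_one hF hS (fun i => Real.log (N / d i)) hx
  convert this using 3
  · ext i
    have : (d i : ℂ) ≠ 0 := by exact_mod_cast (hd i).ne'
    change _ = Complex.exp _ * _
    rw [Complex.exp_neg, ← Complex.ofReal_exp, Real.exp_log (div_pos h0 (hd i))]
    rw [polarPartner, ← hN]
    simp only [diagMap, PiLp.smul_apply, Complex.real_smul]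
    push_cast
    field_simp
  · ext i
    have : (d i : ℂ) ≠ 0 := by exact_mod_cast (hd i).ne'
    change _ = Complex.exp _ * _
    rw [← Complex.ofReal_exp, Real.exp_log (div_pos h0 (hd i))]
    simp only [diagMap, PiLp.smul_apply, Complex.real_smul]
    push_cast
    field_simp

/-- In dimension at least two there are partners `z`, `w` that both lie outside the closed unit
ball, and by density both can be moved into `Ω`. -/
theorem exists_mem_polarPartner_mem {k : ℕ} (hk : 2 ≤ k) {Ω : Set (ComplexSpace k)}
    (hΩ : IsOpen Ω) (hsub : Ω ⊆ (Metric.closedBall 0 1)ᶜ)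
    (hd : (Metric.closedBall 0 1)ᶜ ⊆ closure Ω) :
    ∃ d : Fin k → ℝ, (∀ i, 0 < d i) ∧ ∃ w ∈ Ω, polarPartner d w ∈ Ω := by
  have hW : IsOpen (Metric.closedBall (0 : ComplexSpace k) 1)ᶜ :=
    Metric.isClosed_closedBall.isOpen_compl
  have hne {z : ComplexSpace k} (hz : z ∈ (Metric.closedBall (0 : ComplexSpace k) 1)ᶜ) : z ≠ 0 := by
    rintro rfl; simp at hz
  set i0 : Fin k := ⟨0, by omega⟩
  set i1 : Fin k := ⟨1, by omega⟩
  have h01 : i0 ≠ i1 := by simp [i0, i1]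
  set d : Fin k → ℝ := fun i => if i = i0 then 2 else if i = i1 then 1 / 2 else 1 with hdd
  have hdpos (i : Fin k) : 0 < d i := by simp only [hdd]; split_ifs <;> norm_num
  set w₀ : ComplexSpace k := EuclideanSpace.single i0 (3 / 8) + EuclideanSpace.single i1 (3 / 2)
  have hA : diagMap d w₀ = EuclideanSpace.single i0 (3 / 4) + EuclideanSpace.single i1 (3 / 4) := by
    ext i
    by_cases h0 : i = i0
    · subst h0; simp [diagMap, hdd, w₀, h01]; norm_num
    by_cases h1 : i = i1
    · subst h1; simp [diagMap, hdd, w₀, h01.symm]; norm_num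
    simp [diagMap, w₀, h0, h1]
  have hN : ‖diagMap d w₀‖ ^ 2 = 9 / 8 := by
    rw [hA, @norm_add_sq ℂ, PiLp.norm_single, PiLp.norm_single,
      EuclideanSpace.inner_single_left]
    simp [h01]
    norm_num
  have hw₀ : w₀ ∈ (Metric.closedBall (0 : ComplexSpace k) 1)ᶜ := by
    have := PiLp.norm_apply_le w₀ i1
    simp [w₀, h01.symm] at this
    simp
    linarith
  have hz₀ : polarPartner d w₀ ∈ (Metric.closedBall (0 : ComplexSpace k) 1)ᶜ := by
    have := PiLp.norm_apply_le (polarPartner d w₀) i0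
    have hval : polarPartner d w₀ i0 = ((4 / 3 : ℝ) : ℂ) := by
      rw [polarPartner, hN, hA]
      simp [diagMap, hdd, h01]
      norm_num
    rw [hval, Complex.norm_real] at this
    norm_num at this
    rw [Set.mem_compl_iff, mem_closedBall_zero_iff]
    linarith
  refine ⟨d, hdpos, ?_⟩
  -- move `w₀` into `Ω`, then move its partner into `Ω` so little that `w` stays in the open set `Ω`
  obtain ⟨w₁, hw₁z, hw₁⟩ := mem_closure_iff_nhds.1 (hd hw₀) _
    ((continuousAt_polarPartner hdpos (hne hw₀)).preimage_mem_nhds (hW.mem_nhds hz₀))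
  have hinv : ∀ i, 0 < (d i)⁻¹ := fun i => inv_pos.2 (hdpos i)
  have hcont := continuousAt_polarPartner hinv (polarPartner_ne_zero hdpos (hne (hsub hw₁)))
  obtain ⟨z, hz, hzΩ⟩ := mem_closure_iff_nhds.1 (hd hw₁z) _ (hcont.preimage_mem_nhds (by
    rw [polarPartner_inv_polarPartner hdpos (hne (hsub hw₁))]
    exact hΩ.mem_nhds hw₁))
  refine ⟨_, hz, ?_⟩
  have := polarPartner_inv_polarPartner hinv (hne (hsub hzΩ))
  simp only [inv_inv] at this
  rwa [this]

/-- The open unit ball is the complement of `closure Ω`, so a homeomorphism that preserves `Ω`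
preserves the ball and its boundary. -/
theorem norm_map_eq_one_of_preimage_eq {k : ℕ} {Ω : Set (ComplexSpace k)}
    (hsub : Ω ⊆ (Metric.closedBall 0 1)ᶜ) (hd : (Metric.closedBall 0 1)ᶜ ⊆ closure Ω)
    (F : ComplexSpace k ≃ₜ ComplexSpace k) (hF : F ⁻¹' Ω = Ω) (x : ComplexSpace k)
    (hx : ‖x‖ = 1) : ‖F x‖ = 1 := by
  have hcl : closure Ω = (Metric.ball 0 1)ᶜ := by
    refine subset_antisymm ?_ ?_
    · exact closure_minimal (hsub.trans (Set.compl_subset_compl.2 Metric.ball_subset_closedBall))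
        Metric.isOpen_ball.isClosed_compl
    · rw [← interior_closedBall _ one_ne_zero, ← closure_compl]
      exact closure_minimal hd isClosed_closure
  have hb : F ⁻¹' (Metric.ball 0 1) = Metric.ball 0 1 := by
    rw [← compl_inj_iff, ← Set.preimage_compl, ← hcl, F.preimage_closure, hF]
  have hcb : F ⁻¹' (Metric.closedBall 0 1) = Metric.closedBall 0 1 := by
    rw [← closure_ball _ one_ne_zero, F.preimage_closure, hb]
  have h1 := Set.ext_iff.1 hb x
  have h2 := Set.ext_iff.1 hcb x
  simp only [Set.mem_preimage, mem_ball_zero_iff, mem_closedBall_zero_iff, hx] at h1 h2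
  exact le_antisymm (by simpa using h2) (not_lt.1 (by simpa using h1))

theorem ne_attractingBasin_of_dense_compl_closedBall {k : ℕ} (hk : 2 ≤ k)
    {Ω : Set (ComplexSpace k)} (hΩ : IsOpen Ω) (hsub : Ω ⊆ (Metric.closedBall 0 1)ᶜ)
    (hd : (Metric.closedBall 0 1)ᶜ ⊆ closure Ω) {F : ComplexSpace k → ComplexSpace k}
    (hF : IsHolomorphicAut F) (p : ComplexSpace k) : Ω ≠ attractingBasin (fun _ => F) p := by
  intro hb
  have hmem (z : ComplexSpace k) : z ∈ Ω ↔ Tendsto (fun j => F^[j] z) atTop (𝓝 p) := by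
    rw [hb]
    simp only [attractingBasin, seqComp_const, Set.mem_ofPred_eq]
  obtain ⟨hFd, G, hGd, hGF, hFG⟩ := hF
  have hpre : F ⁻¹' Ω = Ω := by
    ext z
    rw [Set.mem_preimage, hmem, hmem, ← tendsto_add_atTop_iff_nat (f := fun j => F^[j] z) 1]
    simp only [Function.iterate_succ_apply]
  have hS := norm_map_eq_one_of_preimage_eq hsub hd
    ⟨⟨F, G, hGF, hFG⟩, hFd.continuous, hGd.continuous⟩ hpre
  have hSn (n : ℕ) : ∀ x, ‖x‖ = 1 → ‖F^[n] x‖ = 1 := by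
    induction n with
    | zero => exact fun x hx => hx
    | succ n ih => exact fun x hx => ih _ (hS x hx)
  obtain ⟨d, hdpos, w, hw, hz⟩ := exists_mem_polarPartner_mem hk hΩ hsub hd
  have hw0 : w ≠ 0 := by rintro rfl; simpa using hsub hw
  have hlim := ((hmem _).1 hz).inner (𝕜 := ℂ) ((hmem _).1 hw)
  have hone : inner ℂ p p = 1 := by
    refine tendsto_nhds_unique hlim (tendsto_const_nhds.congr fun n => ?_)
    exact (inner_map_polarPartner_map_eq_one (hFd.iterate n) (hSn n) hdpos hw0).symm
  have hnorm : ‖p‖ = 1 := by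
    have : ‖p‖ ^ 2 = 1 := by
      rw [← @inner_self_eq_norm_sq ℂ, hone, RCLike.one_re]
    nlinarith [norm_nonneg p]
  have hfix : F p = p := by
    refine tendsto_nhds_unique ?_ ((tendsto_add_atTop_iff_nat 1).2 ((hmem _).1 hw))
    simp only [Function.iterate_succ_apply']
    exact (hFd.continuous.tendsto p).comp ((hmem _).1 hw)
  have hp : p ∈ Ω := by
    rw [hmem]
    exact tendsto_const_nhds.congr fun n => (Function.iterate_fixed hfix n).symm
  have := hsub hp
  simp [hnorm] at this

/-! ### Push-out sequences -/

/-- A push-out sequence: automorphisms `Φ n` with inverses `Ψ n`, radii `R n` and errors `e n` such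
that the transition map `Φ (n + 1) ∘ Ψ n` and its inverse are `e n`-close to the identity on the
closed ball of radius `R n`. The error `e n` is small with respect to the modulus of continuity of
`Ψ n`; the factor `2` in that condition accounts for the sum of all later errors. -/
structure IsPushOut {E : Type*} [NormedAddCommGroup E] [NormedSpace ℂ E] (Φ Ψ : ℕ → E → E)
    (R e : ℕ → ℝ) : Prop where
  differentiable_map : ∀ n, Differentiable ℂ (Φ n)
  differentiable_inv : ∀ n, Differentiable ℂ (Ψ n)
  inv_map : ∀ n z, Ψ n (Φ n z) = z
  map_inv : ∀ n w, Φ n (Ψ n w) = w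
  radius_add_one_le : ∀ n, R n + 1 ≤ R (n + 1)
  error_pos : ∀ n, 0 < e n
  error_zero_le : e 0 ≤ 1 / 2
  error_succ_le : ∀ n, e (n + 1) ≤ e n / 2
  norm_map_succ_inv_sub_le : ∀ n w, ‖w‖ ≤ R n → ‖Φ (n + 1) (Ψ n w) - w‖ ≤ e n
  norm_map_inv_succ_sub_le : ∀ n w, ‖w‖ ≤ R n → ‖Φ n (Ψ (n + 1) w) - w‖ ≤ e n
  norm_inv_sub_inv_le : ∀ n a b, ‖a‖ ≤ R n → ‖b‖ ≤ R n → ‖a - b‖ ≤ 2 * e n →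
    ‖Ψ n a - Ψ n b‖ ≤ (1 / 2) ^ n

namespace IsPushOut

variable {E : Type*} [NormedAddCommGroup E] [NormedSpace ℂ E] {Φ Ψ : ℕ → E → E} {R e : ℕ → ℝ}

theorem error_le (h : IsPushOut Φ Ψ R e) (n : ℕ) : e n ≤ (1 / 2) ^ (n + 1) := by
  induction n with
  | zero => simpa using h.error_zero_le
  | succ n ih => rw [pow_succ]; linarith [h.error_succ_le n]

theorem error_le_half (h : IsPushOut Φ Ψ R e) (n : ℕ) : e n ≤ 1 / 2 :=
  (h.error_le n).trans (by
    rw [pow_succ]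
    linarith [pow_le_one₀ (n := n) (by norm_num : (0 : ℝ) ≤ 1 / 2) (by norm_num)])

theorem tendsto_error (h : IsPushOut Φ Ψ R e) : Tendsto e atTop (𝓝 0) := by
  refine squeeze_zero (fun n => (h.error_pos n).le) h.error_le ?_
  exact (tendsto_pow_atTop_nhds_zero_of_lt_one (by norm_num) (by norm_num)).comp
    (tendsto_add_atTop_nat 1)

theorem radius_le (h : IsPushOut Φ Ψ R e) {n m : ℕ} (hnm : n ≤ m) : R n ≤ R m :=
  monotone_nat_of_le_succ (fun n => by linarith [h.radius_add_one_le n]) hnm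

theorem exists_le_radius (h : IsPushOut Φ Ψ R e) (r : ℝ) : ∃ n, r ≤ R n := by
  have hn (n : ℕ) : R 0 + n ≤ R n := by
    induction n with
    | zero => simp
    | succ n ih => push_cast; linarith [h.radius_add_one_le n]
  obtain ⟨n, hn'⟩ := exists_nat_ge (r - R 0)
  exact ⟨n, by linarith [hn n]⟩

theorem norm_map_sub_map_le (h : IsPushOut Φ Ψ R e) {n m : ℕ} (hnm : n ≤ m) {z : E}
    (hz : ‖Φ n z‖ ≤ R n - 1) : ‖Φ m z - Φ n z‖ ≤ 2 * (e n - e m) := by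
  induction m, hnm using Nat.le_induction with
  | base => simp
  | succ m hnm ih =>
    have h1 : ‖Φ m z‖ ≤ R m := by
      have := norm_le_norm_add_norm_sub' (Φ m z) (Φ n z)
      linarith [h.radius_le hnm, h.error_le_half n, h.error_pos m]
    have h2 := h.norm_map_succ_inv_sub_le m _ h1
    rw [h.inv_map] at h2
    have := norm_sub_le_norm_sub_add_norm_sub (Φ (m + 1) z) (Φ m z) (Φ n z)
    linarith [h.error_succ_le m]

theorem norm_map_inv_sub_le (h : IsPushOut Φ Ψ R e) {n m : ℕ} (hnm : n ≤ m) {w : E}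
    (hw : ‖w‖ ≤ R n - 1) : ‖Φ n (Ψ m w) - w‖ ≤ 2 * (e n - e m) := by
  induction hnm using Nat.decreasingInduction with
  | self => simp [h.map_inv]
  | of_succ n hnm ih =>
    have h1 := ih (by linarith [h.radius_add_one_le n])
    set x := Φ (n + 1) (Ψ m w) with hx
    have h2 : ‖x‖ ≤ R n := by
      have := norm_le_norm_add_norm_sub' x w
      linarith [h.error_le_half (n + 1), h.error_pos m]
    have h3 := h.norm_map_inv_succ_sub_le n x h2
    rw [hx, h.inv_map, ← hx] at h3
    have := norm_sub_le_norm_sub_add_norm_sub (Φ n (Ψ m w)) x w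
    linarith [h.error_succ_le n]

theorem norm_inv_succ_sub_inv_le (h : IsPushOut Φ Ψ R e) (n : ℕ) {w : E} (hw : ‖w‖ ≤ R n - 1) :
    ‖Ψ (n + 1) w - Ψ n w‖ ≤ (1 / 2) ^ n := by
  have h1 := h.norm_map_inv_succ_sub_le n w (by linarith)
  have h2 : ‖Φ n (Ψ (n + 1) w)‖ ≤ R n := by
    have := norm_le_norm_add_norm_sub' (Φ n (Ψ (n + 1) w)) w
    linarith [h.error_le_half n]
  have := h.norm_inv_sub_inv_le n _ w h2 (by linarith) (by linarith [h.error_pos n])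
  rwa [h.inv_map] at this

theorem norm_inv_sub_inv_le_of_le (h : IsPushOut Φ Ψ R e) {n m : ℕ} (hnm : n ≤ m) {w : E}
    (hw : ‖w‖ ≤ R n - 1) : ‖Ψ m w - Ψ n w‖ ≤ 2 * (1 / 2) ^ n - 2 * (1 / 2) ^ m := by
  induction m, hnm using Nat.le_induction with
  | base => simp
  | succ m hnm ih =>
    have := norm_sub_le_norm_sub_add_norm_sub (Ψ (m + 1) w) (Ψ m w) (Ψ n w)
    have := h.norm_inv_succ_sub_inv_le m (w := w) (by linarith [h.radius_le hnm])
    rw [pow_succ]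
    linarith

theorem eventually_le_radius (h : IsPushOut Φ Ψ R e) (r : ℝ) : ∀ᶠ n in atTop, r ≤ R n := by
  obtain ⟨n, hn⟩ := h.exists_le_radius r
  filter_upwards [eventually_ge_atTop n] with m hm using hn.trans (h.radius_le hm)

theorem norm_map_le (h : IsPushOut Φ Ψ R e) {n m : ℕ} (hnm : n ≤ m) {z : E}
    (hz : ‖Φ n z‖ ≤ R n - 2) : ‖Φ m z‖ ≤ R m - 1 := by
  have h1 := h.norm_map_sub_map_le hnm (z := z) (by linarith)
  have := norm_le_norm_add_norm_sub' (Φ m z) (Φ n z)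
  linarith [h.radius_le hnm, h.error_le_half n, h.error_pos m]

theorem cauchySeq_map (h : IsPushOut Φ Ψ R e) {n : ℕ} {z : E} (hz : ‖Φ n z‖ ≤ R n - 2) :
    CauchySeq fun m => Φ m z := by
  rw [Metric.cauchySeq_iff']
  intro ε hε
  obtain ⟨N, hN, hnN⟩ := ((h.tendsto_error.eventually_lt_const (half_pos hε)).and
    (eventually_ge_atTop n)).exists
  refine ⟨N, fun m hm => ?_⟩
  have := h.norm_map_sub_map_le hm (h.norm_map_le hnN hz)
  rw [dist_eq_norm]
  linarith [h.error_pos m]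

theorem cauchySeq_inv (h : IsPushOut Φ Ψ R e) (w : E) : CauchySeq fun m => Ψ m w := by
  rw [Metric.cauchySeq_iff']
  intro ε hε
  have ht : Tendsto (fun n : ℕ => ((1 : ℝ) / 2) ^ n) atTop (𝓝 0) :=
    tendsto_pow_atTop_nhds_zero_of_lt_one (by norm_num) (by norm_num)
  obtain ⟨N, hN, hnN⟩ := ((ht.eventually_lt_const (half_pos hε)).and
    (h.eventually_le_radius (‖w‖ + 1))).exists
  refine ⟨N, fun m hm => ?_⟩
  have := h.norm_inv_sub_inv_le_of_le hm (w := w) (by linarith)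
  rw [dist_eq_norm]
  have : (0 : ℝ) < (1 / 2) ^ m := by positivity
  linarith

/-- The set of points `z` for which `Φ n z` converges, that is, the points that a push-out sequence
does not push out to infinity. -/
def domain (Φ : ℕ → E → E) : Set E := {z | ∃ w, Tendsto (fun n => Φ n z) atTop (𝓝 w)}

theorem exists_norm_map_lt (h : IsPushOut Φ Ψ R e) {z : E} (hz : z ∈ domain Φ) :
    ∃ n, ‖Φ n z‖ < R n - 2 := by
  obtain ⟨w, hw⟩ := hz
  obtain ⟨n, h1, h2⟩ := ((hw.norm.eventually_lt_const (lt_add_one ‖w‖)).and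
    (h.eventually_le_radius (‖w‖ + 3))).exists
  exact ⟨n, by linarith⟩

variable [CompleteSpace E]

theorem mem_domain_of_norm_map_le (h : IsPushOut Φ Ψ R e) {n : ℕ} {z : E}
    (hz : ‖Φ n z‖ ≤ R n - 2) : z ∈ domain Φ :=
  cauchySeq_tendsto_of_complete (h.cauchySeq_map hz)

theorem isOpen_domain (h : IsPushOut Φ Ψ R e) : IsOpen (domain Φ) := by
  have : domain Φ = ⋃ n, {z | ‖Φ n z‖ < R n - 2} := by
    ext z
    simp only [Set.mem_iUnion]
    exact ⟨h.exists_norm_map_lt, fun ⟨n, hn⟩ => h.mem_domain_of_norm_map_le (le_of_lt hn)⟩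
  rw [this]
  exact isOpen_iUnion fun n =>
    isOpen_lt (h.differentiable_map n).continuous.norm continuous_const

/-- The domain of a push-out sequence is biholomorphic to the whole space, through the limits `f` of
the maps and `Θ` of their inverses. -/
theorem exists_biholomorphic (h : IsPushOut Φ Ψ R e) : ∃ Θ f : E → E, Differentiable ℂ Θ ∧
    DifferentiableOn ℂ f (domain Φ) ∧ (∀ w, Θ w ∈ domain Φ) ∧ (∀ w, f (Θ w) = w) ∧
    ∀ z ∈ domain Φ, Θ (f z) = z := by
  have hpow : Tendsto (fun n : ℕ => ((1 : ℝ) / 2) ^ n) atTop (𝓝 0) :=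
    tendsto_pow_atTop_nhds_zero_of_lt_one (by norm_num) (by norm_num)
  have hf : ∀ z ∈ domain Φ, ∃ w, Tendsto (fun n => Φ n z) atTop (𝓝 w) := fun z hz => hz
  choose! f hf using hf
  choose Θ hΘ using fun w => cauchySeq_tendsto_of_complete (h.cauchySeq_inv w)
  have hfu {n m : ℕ} (hnm : n ≤ m) {z : E} (hz : ‖Φ n z‖ ≤ R n - 2) :
      ‖Φ m z - f z‖ ≤ 2 * e m := by
    rw [← norm_neg, neg_sub]
    refine le_of_tendsto ((hf z (h.mem_domain_of_norm_map_le hz)).sub_const (Φ m z)).norm ?_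
    filter_upwards [eventually_ge_atTop m] with l hl
    linarith [h.norm_map_sub_map_le hl (h.norm_map_le hnm hz), h.error_pos l]
  have hΘu {n : ℕ} {w : E} (hw : ‖w‖ ≤ R n - 1) : ‖Ψ n w - Θ w‖ ≤ 2 * (1 / 2) ^ n := by
    rw [← norm_neg, neg_sub]
    refine le_of_tendsto ((hΘ w).sub_const (Ψ n w)).norm ?_
    filter_upwards [eventually_ge_atTop n] with l hl
    have : (0 : ℝ) < (1 / 2) ^ l := by positivity
    linarith [h.norm_inv_sub_inv_le_of_le hl hw]
  have hlim (w : E) : Tendsto (fun n => Φ n (Θ w)) atTop (𝓝 w) := by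
    rw [tendsto_iff_norm_sub_tendsto_zero]
    have h0 : Tendsto (fun n => 2 * e n) atTop (𝓝 0) := by simpa using h.tendsto_error.const_mul 2
    refine squeeze_zero' (Eventually.of_forall fun n => norm_nonneg _) ?_ h0
    filter_upwards [h.eventually_le_radius (‖w‖ + 1)] with n hn
    have hc : Tendsto (fun m => Φ n (Ψ m w)) atTop (𝓝 (Φ n (Θ w))) :=
      ((h.differentiable_map n).continuous.tendsto _).comp (hΘ w)
    refine le_of_tendsto (hc.sub_const w).norm ?_
    filter_upwards [eventually_ge_atTop n] with m hm
    linarith [h.norm_map_inv_sub_le hm (w := w) (by linarith), h.error_pos m]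
  refine ⟨Θ, f, fun w => ?_, fun z hz => ?_, fun w => ⟨w, hlim w⟩,
    fun w => tendsto_nhds_unique (hf _ ⟨w, hlim w⟩) (hlim w), fun z hz => ?_⟩
  · refine differentiableAt_of_tendstoUniformlyOn_ball one_pos h.differentiable_inv ?_
    rw [Metric.tendstoUniformlyOn_iff]
    intro ε hε
    filter_upwards [h.eventually_le_radius (‖w‖ + 2),
      hpow.eventually_lt_const (half_pos hε)] with n hn hnε x hx
    have hx' : ‖x‖ ≤ ‖w‖ + 1 := by
      have := norm_le_norm_add_norm_sub' x w
      have : ‖x - w‖ < 1 := by simpa [dist_eq_norm] using hx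
      linarith
    rw [dist_comm, dist_eq_norm]
    linarith [hΘu (n := n) (w := x) (by linarith)]
  · obtain ⟨n, hn⟩ := h.exists_norm_map_lt hz
    obtain ⟨ρ, hρ, hsub⟩ := Metric.isOpen_iff.1 (isOpen_lt
      (h.differentiable_map n).continuous.norm (continuous_const (y := R n - 2))) z hn
    refine (differentiableAt_of_tendstoUniformlyOn_ball hρ
      h.differentiable_map ?_).differentiableWithinAt
    rw [Metric.tendstoUniformlyOn_iff]
    intro ε hε
    filter_upwards [eventually_ge_atTop n,
      h.tendsto_error.eventually_lt_const (half_pos hε)] with m hm hmε x hx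
    rw [dist_comm, dist_eq_norm]
    linarith [hfu hm (z := x) (le_of_lt (hsub hx))]
  · obtain ⟨n, hn⟩ := h.exists_norm_map_lt hz
    refine tendsto_nhds_unique (hΘ _) ?_
    rw [tendsto_iff_norm_sub_tendsto_zero]
    refine squeeze_zero' (Eventually.of_forall fun n => norm_nonneg _) ?_ hpow
    filter_upwards [eventually_ge_atTop n, h.eventually_le_radius ‖f z‖] with m hm hmR
    have h1 := h.norm_map_le hm hn.le
    have := h.norm_inv_sub_inv_le m (f z) (Φ m z) hmR (by linarith)
      (by rw [← norm_neg, neg_sub]; exact hfu hm hn.le)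
    rwa [h.inv_map] at this

end IsPushOut

/-! ### Automorphisms that are nearly translations on the unit ball -/

section Automorphism

variable {E : Type*} [NormedAddCommGroup E] [InnerProductSpace ℂ E]

/-- `F` is a holomorphic automorphism with inverse `G`. -/
structure IsAutPair (F G : E → E) : Prop where
  differentiable : Differentiable ℂ F
  differentiable_inv : Differentiable ℂ G
  left_inv : ∀ z, G (F z) = z
  right_inv : ∀ z, F (G z) = z

theorem IsAutPair.comp {F G F' G' : E → E} (h : IsAutPair F G) (h' : IsAutPair F' G') :
    IsAutPair (F ∘ F') (G' ∘ G) where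
  differentiable := h.differentiable.comp h'.differentiable
  differentiable_inv := h'.differentiable_inv.comp h.differentiable_inv
  left_inv z := by simp [h.left_inv, h'.left_inv]
  right_inv z := by simp [h.right_inv, h'.right_inv]

/-- The shear `z ↦ z + h ⟪u, z⟫ v`. It is an automorphism when `v` is orthogonal to `u`. -/
noncomputable def shear (h : ℂ → ℂ) (u v : E) (z : E) : E := z + h (inner ℂ u z) • v

theorem isAutPair_shear {h : ℂ → ℂ} (hh : Differentiable ℂ h) {u v : E} (huv : inner ℂ u v = 0) :
    IsAutPair (shear h u v) (shear (fun z => -h z) u v) where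
  differentiable := by
    have : Differentiable ℂ fun z => inner ℂ u z := (innerSL ℂ u).differentiable
    exact differentiable_id.add ((hh.comp this).smul_const v)
  differentiable_inv := by
    have : Differentiable ℂ fun z => inner ℂ u z := (innerSL ℂ u).differentiable
    exact differentiable_id.add ((hh.neg.comp this).smul_const v)
  left_inv z := by simp [shear, huv]
  right_inv z := by simp [shear, inner_smul_right, huv]

theorem norm_shear_sub_self_le {h : ℂ → ℂ} {u v : E} (hu : ‖u‖ = 1) {R ε C : ℝ} (hv : ‖v‖ ≤ C)
    (hh : ∀ z, ‖z‖ ≤ R → ‖h z‖ * C ≤ ε) {z : E} (hz : ‖z‖ ≤ R) : ‖shear h u v z - z‖ ≤ ε := by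
  rw [shear, add_sub_cancel_left, norm_smul]
  refine le_trans (by gcongr) (hh (inner ℂ u z) ?_)
  exact (norm_inner_le_norm u z).trans (by rwa [hu, one_mul])

/-- On the closed unit ball `Φ` is `δ`-close to a translation to second order: its derivative is
`δ`-close to the identity, and its Taylor remainder has quadratic constant `δ`. -/
def IsNearTranslation (δ : ℝ) (Φ : E → E) : Prop :=
  ∀ z : E, ‖z‖ ≤ 1 → ‖fderiv ℂ Φ z - ContinuousLinearMap.id ℂ E‖ ≤ δ ∧
    ∀ y : E, ‖y‖ ≤ 1 → ‖Φ y - Φ z - fderiv ℂ Φ z (y - z)‖ ≤ δ * ‖y - z‖ ^ 2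

/-- Being near a translation to second order survives, with a slightly larger constant, any
perturbation that is uniformly close to a translation on a neighbourhood of the ball, by Cauchy's
estimates. -/
theorem IsNearTranslation.exists_stable {δ δ' : ℝ} {Φ : E → E} (h : IsNearTranslation δ Φ)
    (hΦ : Differentiable ℂ Φ) (hδ : δ < δ') {s : ℝ} (hs : 0 < s) :
    ∃ ε > 0, ∀ (Φ' : E → E) (v : E), Differentiable ℂ Φ' →
      (∀ y, ‖y‖ ≤ 1 + s → ‖Φ' y - Φ y - v‖ ≤ ε) → IsNearTranslation δ' Φ' := by
  have hη : 0 < δ' - δ := sub_pos.2 hδ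
  set ε := min ((δ' - δ) * s / 2) ((δ' - δ) * s ^ 2 / 4) with hε
  have h1 : 2 * ε / s ≤ δ' - δ := by
    rw [div_le_iff₀ hs]; linarith [min_le_left ((δ' - δ) * s / 2) ((δ' - δ) * s ^ 2 / 4)]
  have h2 : 4 * ε / s ^ 2 ≤ δ' - δ := by
    rw [div_le_iff₀ (by positivity)]
    linarith [min_le_right ((δ' - δ) * s / 2) ((δ' - δ) * s ^ 2 / 4)]
  refine ⟨ε, by positivity, fun Φ' v hΦ' hcl z hz => ?_⟩
  set g : E → E := fun y => Φ' y - Φ y - v with hg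
  have hgd : Differentiable ℂ g := (hΦ'.sub hΦ).sub_const v
  have hfd : fderiv ℂ g z = fderiv ℂ Φ' z - fderiv ℂ Φ z := by
    rw [hg, fderiv_sub_const]
    exact fderiv_sub (hΦ' z) (hΦ z)
  have hb : ∀ w ∈ Metric.ball z s, ‖g w‖ ≤ ε := fun w hw => by
    have := norm_le_norm_add_norm_sub' w z
    rw [Metric.mem_ball, dist_eq_norm] at hw
    exact hcl w (by linarith)
  refine ⟨?_, fun y hy => ?_⟩
  · have h3 := norm_fderiv_le_of_norm_le_on_ball hs hgd.differentiableOn hb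
    rw [hfd] at h3
    have := norm_sub_le_norm_sub_add_norm_sub (fderiv ℂ Φ' z) (fderiv ℂ Φ z)
      (ContinuousLinearMap.id ℂ E)
    linarith [(h z hz).1]
  · have h3 := norm_taylor_remainder_le_of_norm_le_on_ball hs hgd.differentiableOn hb
      (hcl y (by linarith))
    have h4 := (h z hz).2 y hy
    have h5 : Φ' y - Φ' z - fderiv ℂ Φ' z (y - z) = (g y - g z - fderiv ℂ g z (y - z))
        + (Φ y - Φ z - fderiv ℂ Φ z (y - z)) := by
      rw [hfd, sub_apply]; simp only [hg]; abel
    rw [h5]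
    refine (norm_add_le _ _).trans ?_
    nlinarith [sq_nonneg ‖y - z‖]

theorem IsNearTranslation.norm_map_sub_le {δ : ℝ} {Φ : E → E} (h : IsNearTranslation δ Φ)
    (hδ : δ < 1 / 8) {y : E} (hy : ‖y‖ ≤ 1) : ‖Φ y - Φ 0‖ < 2 := by
  obtain ⟨h1, h2⟩ := h 0 (by simp)
  have h2 := h2 y hy
  rw [sub_zero] at h2
  have h3 : ‖fderiv ℂ Φ 0 y - y‖ ≤ δ * ‖y‖ :=
    (ContinuousLinearMap.le_opNorm (fderiv ℂ Φ 0 - ContinuousLinearMap.id ℂ E) y).trans (by gcongr)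
  have hδ0 : 0 ≤ δ := (norm_nonneg _).trans h1
  have h4 := norm_le_norm_add_norm_sub' (fderiv ℂ Φ 0 y) y
  have h5 := norm_le_norm_add_norm_sub' (Φ y - Φ 0) (fderiv ℂ Φ 0 y)
  nlinarith [norm_nonneg y]

/-- A real hyperplane strictly separates `Φ q` from the image of the closed unit ball. Its normal is
`n = Φ q - Φ z`, with `Φ z` the point of that image nearest to `Φ q`: the first-order condition at
`z`, improved by the strong convexity of the ball to a quadratic gain, dominates the Taylor
remainder. -/
theorem IsNearTranslation.exists_separating {δ : ℝ} {Φ : E → E} [FiniteDimensional ℂ E]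
    (h : IsNearTranslation δ Φ) (hδ : δ < 1 / 8) (hΦ : Continuous Φ)
    (hinj : Function.Injective Φ) {q : E} (hq : 1 < ‖q‖) :
    ∃ u : E, ‖u‖ = 1 ∧ ∃ d > 0, ∀ y, ‖y‖ ≤ 1 →
      (inner ℂ u (Φ y)).re ≤ (inner ℂ u (Φ q)).re - d := by
  have : ProperSpace E := FiniteDimensional.proper ℂ E
  obtain ⟨z, hz, hmin⟩ := (isCompact_closedBall (0 : E) 1).exists_isMinOn
    ⟨0, by simp⟩ (f := fun y => ‖Φ y - Φ q‖) (by fun_prop)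
  rw [mem_closedBall_zero_iff] at hz
  have hmin' (y : E) (hy : ‖y‖ ≤ 1) : ‖Φ z - Φ q‖ ≤ ‖Φ y - Φ q‖ :=
    hmin (mem_closedBall_zero_iff.2 hy)
  set n := Φ q - Φ z with hn
  have hn0 : 0 < ‖n‖ := by
    rw [norm_pos_iff, hn, sub_ne_zero]
    intro h0
    rw [hinj h0] at hq
    linarith
  obtain ⟨hD, hT⟩ := h z hz
  set D := fderiv ℂ Φ z
  have hδ0 : 0 ≤ δ := (norm_nonneg _).trans hD
  -- first-order condition at the nearest point
  have first (y : E) (hy : ‖y‖ ≤ 1) : (inner ℂ n (D (y - z))).re ≤ 0 := by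
    set w := y - z with hw
    set C := (‖D w‖ + δ * ‖w‖ ^ 2) ^ 2 + 2 * ‖n‖ * (δ * ‖w‖ ^ 2) with hC
    have hC0 : 0 ≤ C := by positivity
    have key (t : ℝ) (ht : 0 < t) (ht1 : t ≤ 1) : 2 * (inner ℂ n (D w)).re ≤ t * C := by
      have hzt : ‖z + (t : ℂ) • w‖ ≤ 1 := by
        have : z + (t : ℂ) • w = ((1 - t : ℝ) : ℂ) • z + (t : ℂ) • y := by
          rw [hw]; push_cast; module
        rw [this]
        refine (norm_add_le _ _).trans ?_
        rw [norm_smul, norm_smul, Complex.norm_real, Complex.norm_real, Real.norm_eq_abs,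
          Real.norm_eq_abs, abs_of_pos ht, abs_of_nonneg (sub_nonneg.2 ht1)]
        nlinarith
      have h1 := hT _ hzt
      rw [add_sub_cancel_left, norm_smul, Complex.norm_real, Real.norm_eq_abs, abs_of_pos ht,
        map_smul] at h1
      set a := Φ (z + (t : ℂ) • w) - Φ z with ha
      have h2 : ‖n‖ ^ 2 ≤ ‖a - n‖ ^ 2 := by
        have := hmin' _ hzt
        rw [← norm_neg, neg_sub, ← hn] at this
        rw [ha, hn, sub_sub_sub_cancel_right]
        gcongr
      rw [@norm_sub_sq ℂ _ _ _ _ a n, ← inner_conj_symm, RCLike.conj_re] at h2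
      have h3 : ‖a‖ ≤ t * (‖D w‖ + δ * ‖w‖ ^ 2) := by
        have := norm_le_norm_add_norm_sub' a ((t : ℂ) • D w)
        rw [norm_smul, Complex.norm_real, Real.norm_eq_abs, abs_of_pos ht] at this
        have : δ * (t * ‖w‖) ^ 2 ≤ t * (δ * ‖w‖ ^ 2) := by
          have : t ^ 2 ≤ t := by nlinarith
          have : 0 ≤ δ * ‖w‖ ^ 2 := by positivity
          nlinarith
        linarith
      have h4 : t * (inner ℂ n (D w)).re ≤ (inner ℂ n a).re + ‖n‖ * (δ * (t * ‖w‖) ^ 2) := by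
        have h5 : (inner ℂ n ((t : ℂ) • D w)).re = t * (inner ℂ n (D w)).re := by
          rw [inner_smul_right, Complex.re_ofReal_mul]
        have h6 := (Complex.abs_re_le_norm _).trans
          ((norm_inner_le_norm (𝕜 := ℂ) n (a - (t : ℂ) • D w)).trans
            (mul_le_mul_of_nonneg_left h1 hn0.le))
        rw [inner_sub_right, Complex.sub_re, h5] at h6
        linarith [neg_abs_le ((inner ℂ n a).re - t * (inner ℂ n (D w)).re)]
      have h7 : ‖a‖ ^ 2 ≤ t ^ 2 * (‖D w‖ + δ * ‖w‖ ^ 2) ^ 2 := by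
        rw [← mul_pow]; gcongr
      have h8 : t * (2 * (inner ℂ n (D w)).re) ≤ t * (t * C) := by
        simp only [RCLike.re_eq_complex_re] at h2
        rw [hC]
        nlinarith
      exact le_of_mul_le_mul_left h8 ht
    by_contra! hpos
    set r := (inner ℂ n (D w)).re
    have h1 := key (min 1 (r / (C + 1))) (by positivity) (min_le_left _ _)
    have h2 : min 1 (r / (C + 1)) * C ≤ r := by
      calc _ ≤ r / (C + 1) * C := by gcongr; exact min_le_right _ _
        _ = r * (C / (C + 1)) := by ring
        _ ≤ r * 1 := by gcongr; rw [div_le_one (by positivity)]; linarith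
        _ = r := mul_one r
    linarith
  -- strong convexity: the first-order condition applies to the midpoint of `y` and `z` moved by
  -- `‖y - z‖ ^ 2 / 8` in the direction of `n`, which still lies in the ball
  have second (y : E) (hy : ‖y‖ ≤ 1) :
      (inner ℂ n (D (y - z))).re ≤ - (7 / 32 * ‖n‖ * ‖y - z‖ ^ 2) := by
    set b : ℝ := ‖y - z‖ ^ 2 / (8 * ‖n‖) with hb
    have hb0 : 0 ≤ b := by positivity
    set y' := (1 / 2 : ℂ) • (y + z) + (b : ℂ) • n with hy'
    have hmid : ‖(1 / 2 : ℂ) • (y + z)‖ ≤ 1 - ‖y - z‖ ^ 2 / 8 := by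
      have hp := parallelogram_law_with_norm ℂ y z
      have hle : ‖y - z‖ ≤ 2 := (norm_sub_le _ _).trans (by linarith)
      have h1 : ‖y + z‖ ^ 2 ≤ (2 * (1 - ‖y - z‖ ^ 2 / 8)) ^ 2 := by
        nlinarith [norm_nonneg y, norm_nonneg z, norm_nonneg (y - z), sq_nonneg (‖y - z‖ ^ 2)]
      have h2 := abs_le_of_sq_le_sq h1 (by nlinarith [norm_nonneg (y - z)])
      rw [norm_smul]
      norm_num
      linarith [(le_abs_self _).trans h2]
    have hbn : ‖(b : ℂ) • n‖ = ‖y - z‖ ^ 2 / 8 := by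
      rw [norm_smul, Complex.norm_real, Real.norm_eq_abs, abs_of_nonneg hb0, hb]
      field_simp
    have h1 := first y' ((norm_add_le _ _).trans (by linarith))
    have h2 : y' - z = ((1 / 2 : ℝ) : ℂ) • (y - z) + (b : ℂ) • n := by
      rw [hy']; push_cast; module
    rw [h2, map_add, map_smul, map_smul, inner_add_right, inner_smul_right, inner_smul_right,
      Complex.add_re, Complex.re_ofReal_mul, Complex.re_ofReal_mul] at h1
    have h3 : 7 / 8 * ‖n‖ ^ 2 ≤ (inner ℂ n (D n)).re := by
      have h4 : ‖D n - n‖ ≤ δ * ‖n‖ :=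
        (ContinuousLinearMap.le_opNorm (D - ContinuousLinearMap.id ℂ E) n).trans (by gcongr)
      have h5 := (Complex.abs_re_le_norm _).trans ((norm_inner_le_norm (𝕜 := ℂ) n (D n - n)).trans
        (mul_le_mul_of_nonneg_left h4 hn0.le))
      have h6 : (inner ℂ n n).re = ‖n‖ ^ 2 := inner_self_eq_norm_sq (𝕜 := ℂ) n
      rw [inner_sub_right, Complex.sub_re, h6] at h5
      nlinarith [neg_abs_le ((inner ℂ n (D n)).re - ‖n‖ ^ 2)]
    have h4 : b * (7 / 8 * ‖n‖ ^ 2) = 7 / 64 * ‖n‖ * ‖y - z‖ ^ 2 := by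
      rw [hb]; field_simp; ring
    have h5 := mul_le_mul_of_nonneg_left h3 hb0
    linarith
  refine ⟨((‖n‖⁻¹ : ℝ) : ℂ) • n, ?_, ‖n‖, hn0, fun y hy => ?_⟩
  · rw [norm_smul, Complex.norm_real, norm_inv, norm_norm, inv_mul_cancel₀ hn0.ne']
  have h1 : (inner ℂ n (Φ y - Φ z)).re ≤ 0 := by
    have h2 := (Complex.abs_re_le_norm _).trans ((norm_inner_le_norm (𝕜 := ℂ) n
      (Φ y - Φ z - D (y - z))).trans (mul_le_mul_of_nonneg_left (hT y hy) hn0.le))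
    rw [inner_sub_right, Complex.sub_re] at h2
    have h3 := second y hy
    have h4 : 0 ≤ ‖n‖ * ‖y - z‖ ^ 2 := by positivity
    nlinarith [le_abs_self ((inner ℂ n (Φ y - Φ z)).re - (inner ℂ n (D (y - z))).re)]
  have h2 : (inner ℂ n (Φ q - Φ z)).re = ‖n‖ ^ 2 := inner_self_eq_norm_sq (𝕜 := ℂ) n
  rw [inner_sub_right, Complex.sub_re] at h1 h2
  rw [inner_smul_left, inner_smul_left, Complex.conj_ofReal, Complex.re_ofReal_mul,
    Complex.re_ofReal_mul]
  have h3 : ‖n‖⁻¹ * ‖n‖ ^ 2 = ‖n‖ := by field_simp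
  have h4 : ‖n‖⁻¹ * (inner ℂ n (Φ y)).re ≤ ‖n‖⁻¹ * ((inner ℂ n (Φ q)).re - ‖n‖ ^ 2) := by
    gcongr
    linarith
  rw [mul_sub, h3] at h4
  exact h4

end Automorphism

/-! ### Pushing the ball away while trapping a point -/

section Step

variable {E : Type*} [NormedAddCommGroup E] [InnerProductSpace ℂ E]

theorem exists_norm_eq_one_inner_eq_zero [FiniteDimensional ℂ E]
    (hE : 2 ≤ Module.finrank ℂ E) (u : E) :
    ∃ v : E, ‖v‖ = 1 ∧ inner ℂ u v = 0 := by
  have hne : (Submodule.span ℂ {u})ᗮ ≠ ⊥ := by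
    rw [Ne, Submodule.orthogonal_eq_bot_iff]
    intro htop
    have h1 := finrank_span_finset_le_card (R := ℂ) ({u} : Finset E)
    rw [Finset.coe_singleton, Finset.card_singleton] at h1
    rw [Set.finrank, htop, finrank_top] at h1
    omega
  obtain ⟨w, hw, hw0⟩ := Submodule.exists_mem_ne_zero_of_ne_bot hne
  refine ⟨((‖w‖⁻¹ : ℝ) : ℂ) • w, ?_, ?_⟩
  · rw [norm_smul, Complex.norm_real, norm_inv, norm_norm, inv_mul_cancel₀ (norm_ne_zero_iff.2 hw0)]
  · rw [inner_smul_right, Submodule.mem_orthogonal_singleton_iff_inner_right.1 hw, mul_zero]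

/-- If the hyperplane with normal `u` separates `Φ q` from the image of the unit ball and the
projection of that image along `u` is far from the origin, then a shear close to the identity on the
ball of radius `R` fixes `Φ q` and moves the image of the unit ball outside a much larger ball. -/
theorem exists_push [FiniteDimensional ℂ E] (hE : 2 ≤ Module.finrank ℂ E)
    {Φ : E → E} {δ R ε d : ℝ} {u q : E}
    (hΦ : Differentiable ℂ Φ) (hnear : IsNearTranslation δ Φ) (hδ : δ < 1 / 8) (hu : ‖u‖ = 1)
    (hd : 0 < d)
    (hsep : ∀ y, ‖y‖ ≤ 1 → (inner ℂ u (Φ y)).re ≤ (inner ℂ u (Φ q)).re - d)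
    (hR : 0 ≤ R) (hRu : 2 * R + 100 ≤ ‖inner ℂ u (Φ 0)‖) (hε : 0 < ε) :
    ∃ (F G : E → E) (R' : ℝ), IsAutPair F G ∧ (∀ z, ‖z‖ ≤ R → ‖F z - z‖ ≤ ε) ∧
      (∀ z, ‖z‖ ≤ R → ‖G z - z‖ ≤ ε) ∧ (∃ δ' < 1 / 8, IsNearTranslation δ' (F ∘ Φ)) ∧
      R + 1 ≤ R' ∧ ‖F (Φ q)‖ ≤ R' - 2 ∧ 2 * R' + 102 ≤ ‖F (Φ 0)‖ := by
  have : ProperSpace E := FiniteDimensional.proper ℂ E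
  obtain ⟨v, hv, huv⟩ := exists_norm_eq_one_inner_eq_zero hE u
  have hΦc := hΦ.continuous
  -- a neighbourhood of the closed ball on which the separation persists
  have hU : IsOpen {y | (inner ℂ u (Φ y)).re < (inner ℂ u (Φ q)).re - d / 2 ∧ ‖Φ y - Φ 0‖ < 2} :=
    by
    refine IsOpen.and (isOpen_lt ?_ continuous_const) (isOpen_lt (by fun_prop) continuous_const)
    exact Complex.continuous_re.comp (continuous_const.inner hΦc)
  obtain ⟨s, hs, hsU⟩ := (isCompact_closedBall (0 : E) 1).exists_cthickening_subset_open hU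
    fun y hy => by
      rw [mem_closedBall_zero_iff] at hy
      exact ⟨by linarith [hsep y hy], hnear.norm_map_sub_le hδ hy⟩
  rw [cthickening_closedBall hs.le zero_le_one, add_comm s 1] at hsU
  obtain ⟨δ', hδδ', hδ'⟩ := exists_between hδ
  obtain ⟨η, hη, hstable⟩ := hnear.exists_stable hΦ hδδ' hs
  -- the shear will fix `Φ q`, so the new radius is known before the translation length `M`
  set R' := max (R + 1) (‖Φ q‖ + 2) with hR'
  have hR'0 : 0 < R' := lt_of_lt_of_le (by linarith) (le_max_left _ _)
  set M := 2 * R' + 103 + ‖Φ 0‖ with hM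
  have hM0 : 0 < M := by positivity
  set ε' := min (min ε η) 1 with hε'
  have hε'0 : 0 < ε' := by positivity
  obtain ⟨h, hh, h0, hζ, h1⟩ := exists_entire_approx_step_vanishing (c := inner ℂ u (Φ 0)) (R := R)
    (ζ := inner ℂ u (Φ q)) (by linarith) (by linarith) (half_pos hd) (div_pos hε'0 hM0)
  set H : ℂ → ℂ := fun z => M * h z with hH
  have hHd : Differentiable ℂ H := (differentiable_const _).mul hh
  have hHR (z : ℂ) (hz : ‖z‖ ≤ R) : ‖H z‖ * 1 ≤ ε := by
    rw [mul_one, norm_mul, Complex.norm_real, Real.norm_eq_abs, abs_of_pos hM0]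
    have := h0 z hz
    rw [le_div_iff₀ hM0] at this
    linarith [min_le_left (min ε η) 1, min_le_left ε η]
  have hmove (y : E) (hy : ‖y‖ ≤ 1 + s) :
      ‖shear H u v (Φ y) - Φ y - (M : ℂ) • v‖ ≤ ε' := by
    obtain ⟨h2, h3⟩ := hsU (mem_closedBall_zero_iff.2 hy)
    have h4 : ‖inner ℂ u (Φ y) - inner ℂ u (Φ 0)‖ ≤ 2 := by
      rw [← inner_sub_right]
      refine (norm_inner_le_norm _ _).trans ?_
      rw [hu, one_mul]
      exact h3.le
    have h5 := h1 _ h4 h2.le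
    rw [shear, add_sub_cancel_left, ← sub_smul, norm_smul, hv, mul_one, hH]
    rw [le_div_iff₀ hM0] at h5
    have : (M : ℂ) * h (inner ℂ u (Φ y)) - M = M * (h (inner ℂ u (Φ y)) - 1) := by ring
    rw [this, norm_mul, Complex.norm_real, Real.norm_eq_abs, abs_of_pos hM0]
    linarith
  have hpair := isAutPair_shear hHd huv
  refine ⟨_, _, R', hpair, fun z hz => norm_shear_sub_self_le hu hv.le hHR hz,
    fun z hz => norm_shear_sub_self_le hu hv.le (fun w hw => by rw [norm_neg]; exact hHR w hw) hz,
    ⟨δ', hδ', hstable _ ((M : ℂ) • v) (hpair.differentiable.comp hΦ) fun y hy => ?_⟩,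
    le_max_left _ _, ?_, ?_⟩
  · exact (hmove y hy).trans ((min_le_left _ _).trans (min_le_right _ _))
  · have : shear H u v (Φ q) = Φ q := by simp [shear, hH, hζ]
    rw [this]
    linarith [le_max_right (R + 1) (‖Φ q‖ + 2)]
  · have h2 := hmove 0 (by simp; linarith)
    have h3 : ‖(M : ℂ) • v‖ = M := by
      rw [norm_smul, hv, mul_one, Complex.norm_real, Real.norm_eq_abs, abs_of_pos hM0]
    set x := shear H u v (Φ 0)
    have h4 := norm_le_norm_add_norm_sub (x - Φ 0) ((M : ℂ) • v)
    have h5 := norm_sub_le x (Φ 0)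
    linarith [min_le_right (min ε η) 1]

/-- If `Φ q` and the image of the unit ball have nearby projections along `u`, far from the origin,
then a shear close to the identity on the ball of radius `R` moves both of them almost exactly by a
given vector `v` orthogonal to `u`. -/
theorem exists_translate [FiniteDimensional ℂ E] {Φ : E → E} {δ R ε : ℝ} {u v q : E}
    (hΦ : Differentiable ℂ Φ) (hnear : IsNearTranslation δ Φ) (hδ : δ < 1 / 8) (hu : ‖u‖ = 1)
    (huv : inner ℂ u v = 0) (hq : ‖inner ℂ u (Φ q - Φ 0)‖ ≤ 2)
    (hRu : 2 * R + 100 ≤ ‖inner ℂ u (Φ 0)‖) (hR : 0 ≤ R) (hε : 0 < ε) :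
    ∃ F G : E → E, IsAutPair F G ∧ (∀ z, ‖z‖ ≤ R → ‖F z - z‖ ≤ ε) ∧
      (∀ z, ‖z‖ ≤ R → ‖G z - z‖ ≤ ε) ∧ (∃ δ' < 1 / 8, IsNearTranslation δ' (F ∘ Φ)) ∧
      (∀ y, ‖y‖ ≤ 1 → ‖F (Φ y) - Φ y - v‖ ≤ ε) ∧ ‖F (Φ q) - Φ q - v‖ ≤ ε := by
  have : ProperSpace E := FiniteDimensional.proper ℂ E
  have hΦc := hΦ.continuous
  have hU : IsOpen {y | ‖Φ y - Φ 0‖ < 2} := isOpen_lt (by fun_prop) continuous_const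
  obtain ⟨s, hs, hsU⟩ := (isCompact_closedBall (0 : E) 1).exists_cthickening_subset_open hU
    fun y hy => hnear.norm_map_sub_le hδ (mem_closedBall_zero_iff.1 hy)
  rw [cthickening_closedBall hs.le zero_le_one, add_comm s 1] at hsU
  obtain ⟨δ', hδδ', hδ'⟩ := exists_between hδ
  obtain ⟨η, hη, hstable⟩ := hnear.exists_stable hΦ hδδ' hs
  set M := ‖v‖ + 1 with hM
  have hM0 : 0 < M := by positivity
  obtain ⟨h, hh, h0, h1⟩ := exists_entire_approx_step (c := inner ℂ u (Φ 0)) (R := R)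
    (by linarith) (by linarith) (div_pos (lt_min hε hη) hM0)
  have hHR (z : ℂ) (hz : ‖z‖ ≤ R) : ‖h z‖ * M ≤ ε := by
    have := h0 z hz
    rw [le_div_iff₀ hM0] at this
    linarith [min_le_left ε η]
  have hmove (y : E) (hy : ‖inner ℂ u (Φ y - Φ 0)‖ ≤ 2) :
      ‖shear h u v (Φ y) - Φ y - v‖ ≤ min ε η := by
    rw [inner_sub_right] at hy
    have h5 := h1 _ hy
    rw [le_div_iff₀ hM0] at h5
    have : shear h u v (Φ y) - Φ y - v = (h (inner ℂ u (Φ y)) - 1) • v := by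
      rw [shear]; module
    rw [this, norm_smul]
    refine le_trans ?_ h5
    gcongr
    linarith
  have hmove' (y : E) (hy : ‖y‖ ≤ 1 + s) : ‖shear h u v (Φ y) - Φ y - v‖ ≤ min ε η := by
    refine hmove y ((norm_inner_le_norm _ _).trans ?_)
    rw [hu, one_mul]
    exact le_of_lt (hsU (mem_closedBall_zero_iff.2 hy))
  have hpair := isAutPair_shear hh huv
  have hvM : ‖v‖ ≤ M := by linarith
  exact ⟨_, _, hpair, fun z hz => norm_shear_sub_self_le hu hvM hHR hz,
    fun z hz => norm_shear_sub_self_le hu hvM (fun w hw => by rw [norm_neg]; exact hHR w hw) hz,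
    ⟨δ', hδ', hstable _ v (hpair.differentiable.comp hΦ) fun y hy =>
      (hmove' y hy).trans (min_le_right _ _)⟩,
    fun y hy => (hmove' y (by linarith)).trans (min_le_left _ _),
    (hmove q hq).trans (min_le_left _ _)⟩

/-- There is an automorphism close to the identity on the ball of radius `R` that traps `Φ q` in a
ball of larger radius `R'` and pushes the image of the unit ball far outside that ball. -/
theorem exists_step [FiniteDimensional ℂ E] (hE : 2 ≤ Module.finrank ℂ E)
    {Φ Ψ : E → E} {δ R ε : ℝ} {q : E}
    (hΦ : IsAutPair Φ Ψ) (hnear : IsNearTranslation δ Φ) (hδ : δ < 1 / 8) (hq : 1 < ‖q‖)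
    (hR : 0 ≤ R) (hRΦ : 2 * R + 102 ≤ ‖Φ 0‖) (hε : 0 < ε) :
    ∃ (F G : E → E) (R' : ℝ), IsAutPair F G ∧ (∀ z, ‖z‖ ≤ R → ‖F z - z‖ ≤ ε) ∧
      (∀ z, ‖z‖ ≤ R → ‖G z - z‖ ≤ ε) ∧ (∃ δ' < 1 / 8, IsNearTranslation δ' (F ∘ Φ)) ∧
      R + 1 ≤ R' ∧ ‖F (Φ q)‖ ≤ R' - 2 ∧ 2 * R' + 102 ≤ ‖F (Φ 0)‖ := by
  have hΦd := hΦ.differentiable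
  obtain ⟨u, hu, d, hd, hsep⟩ := hnear.exists_separating hδ hΦd.continuous
    (Function.LeftInverse.injective hΦ.left_inv) hq
  set p := Φ 0 with hp
  have hp0 : 0 < ‖p‖ := by linarith
  by_cases hup : 2 * R + 102 ≤ ‖inner ℂ u p‖
  · exact exists_push hE hΦd hnear hδ hu hd hsep hR (by linarith) hε
  set a : E := ((‖p‖⁻¹ : ℝ) : ℂ) • p with ha
  have ha1 : ‖a‖ = 1 := by
    rw [ha, norm_smul, Complex.norm_real, norm_inv, norm_norm, inv_mul_cancel₀ hp0.ne']
  have hap : inner ℂ a p = (‖p‖ : ℂ) := by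
    rw [ha, inner_smul_left, Complex.conj_ofReal, inner_self_eq_norm_sq_to_K]
    push_cast
    have : (‖p‖ : ℂ) ≠ 0 := by exact_mod_cast hp0.ne'
    field_simp
    rfl
  by_cases haq : 2 < ‖inner ℂ a (Φ q - p)‖
  · -- rotate `a` so that the inner product becomes a positive real
    set c : ℂ := inner ℂ a (Φ q - p) with hc
    have hc0 : 0 < ‖c‖ := by linarith
    set ω : ℂ := c / ‖c‖ with hω
    have hω1 : ‖ω‖ = 1 := by rw [hω, norm_div, Complex.norm_real, norm_norm, div_self hc0.ne']
    have hub : ‖ω • a‖ = 1 := by rw [norm_smul, hω1, ha1, one_mul]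
    have hre : (inner ℂ (ω • a) (Φ q - p)).re = ‖c‖ := by
      rw [inner_smul_left, ← hc, hω, map_div₀, Complex.conj_ofReal, div_mul_eq_mul_div,
        Complex.conj_mul']
      have : (‖c‖ : ℂ) ^ 2 / ‖c‖ = ((‖c‖ ^ 2 / ‖c‖ : ℝ) : ℂ) := by push_cast; rfl
      rw [this, Complex.ofReal_re]
      field_simp
    refine exists_push hE hΦd hnear hδ hub (sub_pos.2 haq) (fun y hy => ?_) hR ?_ hε
    · have h1 := (Complex.re_le_norm _).trans (norm_inner_le_norm (𝕜 := ℂ) (ω • a) (Φ y - p))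
      rw [hub, one_mul] at h1
      have h2 := hnear.norm_map_sub_le hδ hy
      rw [inner_sub_right, Complex.sub_re] at h1 hre
      linarith
    · rw [inner_smul_left, hap, norm_mul, RCLike.norm_conj, hω1, one_mul, Complex.norm_real,
        norm_norm]
      linarith
  · -- first translate in a direction orthogonal to `a` and not orthogonal to `u`
    set b : E := u - inner ℂ a u • a with hb
    have hab : inner ℂ a b = 0 := by
      rw [hb, inner_sub_right, inner_smul_right, inner_self_eq_norm_sq_to_K, ha1]
      simp
    have hub : inner ℂ u b = (‖b‖ : ℂ) ^ 2 := by
      have : u = b + inner ℂ a u • a := by rw [hb]; abel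
      nth_rewrite 1 [this]
      rw [inner_add_left, inner_smul_left, hab, mul_zero, add_zero, inner_self_eq_norm_sq_to_K]
      rfl
    have hb0 : 0 < ‖b‖ := by
      rw [norm_pos_iff]
      intro h0
      have hu' : u = inner ℂ a u • a := by rwa [hb, sub_eq_zero] at h0
      have h1 : ‖inner ℂ a u‖ = 1 := by
        have := congrArg norm hu'
        rwa [norm_smul, ha1, mul_one, hu, eq_comm] at this
      apply hup
      rw [hu', inner_smul_left, hap, norm_mul, RCLike.norm_conj, h1, one_mul, Complex.norm_real,
        norm_norm]
      exact hRΦ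
    set t : ℝ := (2 * (R + 1) + 101 + ‖p‖) / ‖b‖ ^ 2 with ht
    have ht0 : 0 ≤ t := by positivity
    set ε' := min (min (ε / 2) (d / 4)) 1 with hε'
    have hε'0 : 0 < ε' := by positivity
    have hε'1 : ε' ≤ 1 := min_le_right _ _
    have hε'2 : ε' ≤ ε / 2 := (min_le_left _ _).trans (min_le_left _ _)
    have hε'3 : ε' ≤ d / 4 := (min_le_left _ _).trans (min_le_right _ _)
    obtain ⟨F, G, hFG, hF, hG, ⟨δ₁, hδ₁, hnear₁⟩, hFy, hFq⟩ := exists_translate (R := R + 1)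
      (v := (t : ℂ) • b) (q := q) hΦd hnear hδ ha1 (by rw [inner_smul_right, hab, mul_zero])
      (not_lt.1 haq) (by rw [← hp, hap, Complex.norm_real, norm_norm]; linarith) (by linarith)
      hε'0
    have hre (x : E) (hx : ‖F (Φ x) - Φ x - (t : ℂ) • b‖ ≤ ε') :
        |(inner ℂ u (F (Φ x))).re - (inner ℂ u (Φ x)).re - (inner ℂ u ((t : ℂ) • b)).re| ≤ ε' := by
      have := (Complex.abs_re_le_norm _).trans (norm_inner_le_norm (𝕜 := ℂ) u
        (F (Φ x) - Φ x - (t : ℂ) • b))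
      rw [hu, one_mul, inner_sub_right, inner_sub_right, Complex.sub_re, Complex.sub_re] at this
      exact this.trans hx
    have hsep₁ (y : E) (hy : ‖y‖ ≤ 1) :
        (inner ℂ u ((F ∘ Φ) y)).re ≤ (inner ℂ u ((F ∘ Φ) q)).re - d / 2 := by
      have h1 := hre y (hFy y hy)
      have h2 := hre q hFq
      rw [abs_le] at h1 h2
      have h3 := hsep y hy
      simp only [Function.comp_apply]
      linarith [h1.2, h2.1]
    have hfar : 2 * (R + 1) + 100 ≤ ‖inner ℂ u ((F ∘ Φ) 0)‖ := by
      have h1 := hFy 0 (by simp)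
      have h2 := norm_inner_le_norm (𝕜 := ℂ) u (F (Φ 0) - Φ 0 - (t : ℂ) • b)
      rw [hu, one_mul, inner_sub_right, inner_sub_right, inner_smul_right, hub] at h2
      have h3 : (t : ℂ) * (‖b‖ : ℂ) ^ 2 = ((2 * (R + 1) + 101 + ‖p‖ : ℝ) : ℂ) := by
        rw [← Complex.ofReal_pow, ← Complex.ofReal_mul, ht]
        congr 1
        field_simp
      rw [h3] at h2
      have h4 : ‖((2 * (R + 1) + 101 + ‖p‖ : ℝ) : ℂ)‖ = 2 * (R + 1) + 101 + ‖p‖ := by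
        rw [Complex.norm_real, Real.norm_eq_abs, abs_of_nonneg (by positivity)]
      have h5 := norm_le_norm_add_norm_sub (inner ℂ u (F (Φ 0)) - inner ℂ u (Φ 0))
        ((2 * (R + 1) + 101 + ‖p‖ : ℝ) : ℂ)
      have h6 := norm_sub_le (inner ℂ u (F (Φ 0))) (inner ℂ u (Φ 0))
      have h7 := norm_inner_le_norm (𝕜 := ℂ) u (Φ 0)
      rw [hu, one_mul, ← hp] at h7
      simp only [Function.comp_apply]
      rw [← hp] at *
      linarith
    obtain ⟨F', G', R', hFG', hF', hG', hnear', hR', hq', hp'⟩ := exists_push hE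
      (hFG.differentiable.comp hΦd) hnear₁ hδ₁ hu (half_pos hd) hsep₁ (by linarith) hfar hε'0
    refine ⟨F' ∘ F, G ∘ G', R', hFG'.comp hFG, fun z hz => ?_, fun z hz => ?_, hnear',
      by linarith, hq', hp'⟩
    · have h1 := hF z (by linarith)
      have h2 := hF' (F z) (by linarith [norm_le_norm_add_norm_sub' (F z) z])
      have := norm_sub_le_norm_sub_add_norm_sub (F' (F z)) (F z) z
      simp only [Function.comp_apply]
      linarith
    · have h1 := hG' z (by linarith)
      have h2 := hG (G' z) (by linarith [norm_le_norm_add_norm_sub' (G' z) z])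
      have := norm_sub_le_norm_sub_add_norm_sub (G (G' z)) (G' z) z
      simp only [Function.comp_apply]
      linarith

end Step

/-! ### Construction of the domain -/

section Sequence

variable {E : Type*} [NormedAddCommGroup E] [InnerProductSpace ℂ E]

/-- The data of one stage of a push-out sequence: an automorphism, its inverse, the radius of the
ball on which later changes are small, and the bound on the next change. -/
structure PushOutStage (E : Type*) where
  map : E → E
  inv : E → E
  radius : ℝ
  error : ℝ

/-- The properties of the `n`-th stage that allow the construction to be continued. -/
structure PushOutStage.IsGood (n : ℕ) (s : PushOutStage E) : Prop where
  isAutPair : IsAutPair s.map s.inv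
  nearTranslation : ∃ δ < 1 / 8, IsNearTranslation δ s.map
  radius_nonneg : 0 ≤ s.radius
  radius_le : 2 * s.radius + 102 ≤ ‖s.map 0‖
  error_pos : 0 < s.error
  norm_inv_sub_inv_le : ∀ a b, ‖a‖ ≤ s.radius → ‖b‖ ≤ s.radius → ‖a - b‖ ≤ 2 * s.error →
    ‖s.inv a - s.inv b‖ ≤ (1 / 2) ^ n

/-- The stage `s'` may follow the stage `s`: the transition between them is small, and the point `q`
is trapped if it lies outside the closed unit ball. -/
structure PushOutStage.IsStep (q : E) (s s' : PushOutStage E) : Prop where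
  radius_add_one_le : s.radius + 1 ≤ s'.radius
  error_le : s'.error ≤ s.error / 2
  norm_map_inv_sub_le : ∀ w, ‖w‖ ≤ s.radius → ‖s'.map (s.inv w) - w‖ ≤ s.error
  norm_map_inv_sub_le' : ∀ w, ‖w‖ ≤ s.radius → ‖s.map (s'.inv w) - w‖ ≤ s.error
  norm_map_le : 1 < ‖q‖ → ‖s'.map q‖ ≤ s'.radius - 2

theorem exists_error_of_continuous [FiniteDimensional ℂ E] {Ψ : E → E} (hΨ : Continuous Ψ)
    (R : ℝ) {c η : ℝ} (hc : 0 < c) (hη : 0 < η) :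
    ∃ e, 0 < e ∧ e ≤ c ∧ ∀ a b, ‖a‖ ≤ R → ‖b‖ ≤ R → ‖a - b‖ ≤ 2 * e → ‖Ψ a - Ψ b‖ ≤ η := by
  have : ProperSpace E := FiniteDimensional.proper ℂ E
  obtain ⟨e, he, h⟩ := Metric.uniformContinuousOn_iff.1 ((isCompact_closedBall (0 : E)
    R).uniformContinuousOn_of_continuous hΨ.continuousOn) η hη
  refine ⟨min c (e / 3), by positivity, min_le_left _ _, fun a b ha hb hab => ?_⟩
  rw [← dist_eq_norm]
  refine (h a (mem_closedBall_zero_iff.2 ha) b (mem_closedBall_zero_iff.2 hb) ?_).le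
  rw [dist_eq_norm]
  linarith [min_le_right c (e / 3)]

theorem PushOutStage.IsGood.exists_step [FiniteDimensional ℂ E] (hE : 2 ≤ Module.finrank ℂ E)
    {n : ℕ} {s : PushOutStage E} (hs : s.IsGood n) (q : E) :
    ∃ s' : PushOutStage E, s'.IsGood (n + 1) ∧ s.IsStep q s' := by
  obtain ⟨q', hq', hqq'⟩ : ∃ q' : E, 1 < ‖q'‖ ∧ (1 < ‖q‖ → q' = q) := by
    by_cases hq : 1 < ‖q‖
    · exact ⟨q, hq, fun _ => rfl⟩
    · obtain ⟨v, hv, -⟩ := exists_norm_eq_one_inner_eq_zero hE (0 : E)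
      exact ⟨(2 : ℂ) • v, by rw [norm_smul, hv]; norm_num, fun h => absurd h hq⟩
  obtain ⟨δ, hδ, hnear⟩ := hs.nearTranslation
  obtain ⟨F, G, R', hFG, hF, hG, hnear', hR', hFq, hF0⟩ :=
    _root_.exists_step hE hs.isAutPair hnear hδ hq' hs.radius_nonneg hs.radius_le hs.error_pos
  have hpair := hFG.comp hs.isAutPair
  obtain ⟨e, he, hes, hmod⟩ := exists_error_of_continuous hpair.differentiable_inv.continuous R'
    (half_pos hs.error_pos) (η := (1 / 2) ^ (n + 1)) (by positivity)
  refine ⟨⟨F ∘ s.map, s.inv ∘ G, R', e⟩, ⟨hpair, hnear', by linarith [hs.radius_nonneg], hF0, he,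
    hmod⟩, ⟨hR', hes, fun w hw => ?_, fun w hw => ?_, fun hq => ?_⟩⟩
  · simpa [hs.isAutPair.right_inv] using hF w hw
  · simpa [hs.isAutPair.right_inv] using hG w hw
  · simpa [hqq' hq] using hFq

theorem isNearTranslation_add_const (p : E) : IsNearTranslation 0 fun z => z + p := by
  intro z _
  have : fderiv ℂ (fun z => z + p) z = ContinuousLinearMap.id ℂ E := by
    rw [fderiv_add_const]; exact fderiv_fun_id
  simp [this]

theorem exists_isGood_zero [FiniteDimensional ℂ E] (hE : 2 ≤ Module.finrank ℂ E) :
    ∃ s : PushOutStage E, s.IsGood 0 ∧ s.error ≤ 1 / 2 := by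
  obtain ⟨v, hv, -⟩ := exists_norm_eq_one_inner_eq_zero hE (0 : E)
  set p := (102 : ℂ) • v with hp
  have hp' : ‖p‖ = 102 := by rw [hp, norm_smul, hv]; norm_num
  have hpair : IsAutPair (fun z : E => z + p) (fun z => z - p) :=
    ⟨by fun_prop, by fun_prop, fun z => by simp, fun z => by simp⟩
  obtain ⟨e, he, hes, hmod⟩ := exists_error_of_continuous hpair.differentiable_inv.continuous 0
    (half_pos one_pos) (η := (1 / 2) ^ 0) (by positivity)
  exact ⟨⟨_, _, 0, e⟩, ⟨hpair, ⟨0, by norm_num, isNearTranslation_add_const p⟩, le_rfl,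
    by simp [hp'], he, hmod⟩, hes⟩

/-- There is a push-out sequence that pushes the closed unit ball to infinity and traps all points
of a given sequence that lie outside that ball. -/
theorem exists_isPushOut [FiniteDimensional ℂ E] (hE : 2 ≤ Module.finrank ℂ E) (q : ℕ → E) :
    ∃ (Φ Ψ : ℕ → E → E) (R e : ℕ → ℝ), IsPushOut Φ Ψ R e ∧
      (∀ n y, ‖y‖ ≤ 1 → R n ≤ ‖Φ n y‖) ∧ ∀ n, 1 < ‖q n‖ → ‖Φ (n + 1) (q n)‖ ≤ R (n + 1) - 2 := by
  obtain ⟨s₀, hs₀, he₀⟩ := exists_isGood_zero hE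
  have hstep (n : ℕ) (s : PushOutStage E) : ∃ s' : PushOutStage E,
      s.IsGood n → s'.IsGood (n + 1) ∧ s.IsStep (q n) s' := by
    by_cases hs : s.IsGood n
    · obtain ⟨s', hs'⟩ := hs.exists_step hE (q n)
      exact ⟨s', fun _ => hs'⟩
    · exact ⟨s, fun h => absurd h hs⟩
  choose next hnext using hstep
  let s : ℕ → PushOutStage E := fun n => Nat.rec s₀ next n
  have hgood (n : ℕ) : (s n).IsGood n := by
    induction n with
    | zero => exact hs₀
    | succ n ih => exact (hnext n (s n) ih).1
  have hs (n : ℕ) : (s n).IsStep (q n) (s (n + 1)) := (hnext n (s n) (hgood n)).2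
  refine ⟨fun n => (s n).map, fun n => (s n).inv, fun n => (s n).radius, fun n => (s n).error,
    ⟨fun n => (hgood n).isAutPair.differentiable, fun n => (hgood n).isAutPair.differentiable_inv,
      fun n => (hgood n).isAutPair.left_inv, fun n => (hgood n).isAutPair.right_inv,
      fun n => (hs n).radius_add_one_le, fun n => (hgood n).error_pos, he₀,
      fun n => (hs n).error_le, fun n => (hs n).norm_map_inv_sub_le,
      fun n => (hs n).norm_map_inv_sub_le', fun n => (hgood n).norm_inv_sub_inv_le⟩,
    fun n y hy => ?_, fun n => (hs n).norm_map_le⟩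
  obtain ⟨δ, hδ, hnear⟩ := (hgood n).nearTranslation
  have h1 := hnear.norm_map_sub_le hδ hy
  have h2 := norm_le_norm_add_norm_sub ((s n).map y) ((s n).map 0)
  linarith [(hgood n).radius_le, (hgood n).radius_nonneg]

end Sequence

theorem exists_fatouBieberbachDomain_dense_compl_closedBall {k : ℕ} (hk : 2 ≤ k) :
    ∃ Ω : Set (ComplexSpace k), IsFatouBieberbachDomain Ω ∧
      Ω ⊆ (Metric.closedBall (0 : ComplexSpace k) 1)ᶜ ∧
      (Metric.closedBall (0 : ComplexSpace k) 1)ᶜ ⊆ closure Ω := by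
  obtain ⟨q, hq⟩ := TopologicalSpace.exists_dense_seq (ComplexSpace k)
  obtain ⟨Φ, Ψ, R, e, h, hball, hqn⟩ := exists_isPushOut (E := ComplexSpace k) (by simpa) q
  obtain ⟨Θ, f, hΘ, hf, hmem, hfΘ, hΘf⟩ := h.exists_biholomorphic
  have hsub : IsPushOut.domain Φ ⊆ (Metric.closedBall (0 : ComplexSpace k) 1)ᶜ := by
    intro z hz hz1
    obtain ⟨n, hn⟩ := h.exists_norm_map_lt hz
    linarith [hball n z (mem_closedBall_zero_iff.1 hz1)]
  have hrange : Set.range Θ = IsPushOut.domain Φ :=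
    Set.Subset.antisymm (Set.range_subset_iff.2 hmem) fun z hz => ⟨f z, hΘf z hz⟩
  refine ⟨_, ⟨h.isOpen_domain, ?_, ?_, Θ, f, hΘ, hf, hmem, hfΘ, hΘf⟩, hsub, ?_⟩
  · rw [← hrange]
    exact isConnected_range hΘ.continuous
  · intro huniv
    exact hsub (huniv ▸ Set.mem_univ (0 : ComplexSpace k)) (by simp)
  · refine (hq.open_subset_closure_inter Metric.isClosed_closedBall.isOpen_compl).trans
      (closure_mono ?_)
    rintro _ ⟨hz, n, rfl⟩
    refine h.mem_domain_of_norm_map_le (hqn n ?_)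
    simpa using hz

theorem proposition1 (k : ℕ) (hk : 2 ≤ k) :
    ∃ Ω : Set (ComplexSpace k),
      IsFatouBieberbachDomain Ω ∧
      Ω ⊆ (Metric.closedBall (0 : ComplexSpace k) 1)ᶜ ∧
      (Metric.closedBall (0 : ComplexSpace k) 1)ᶜ ⊆ closure Ω ∧
      ¬ ∃ (F : ComplexSpace k → ComplexSpace k) (p : ComplexSpace k),
        IsHolomorphicAut F ∧ Ω = attractingBasin (fun _ => F) p := by
  obtain ⟨Ω, hΩ, hsub, hdense⟩ := exists_fatouBieberbachDomain_dense_compl_closedBall hk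
  refine ⟨Ω, hΩ, hsub, hdense, ?_⟩
  rintro ⟨F, p, hF, h⟩
  exact ne_attractingBasin_of_dense_compl_closedBall hk hΩ.isOpen hsub hdense hF p h
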